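/- All $C^*$-algebras are unital (the zero algebra is allowed), $\otimes$ is the spatial tensor product and $\iota$ denotes identity maps. A compact quantum group $G=(\mathcal A,\Delta)$ is a unital $C^*$-algebra $\mathcal A$ with a unital $^*$-homomorphism $\Delta:\mathcal A\to\mathcal A\otimes\mathcal A$ such that $(\Delta\otimes\iota)\circ\Delta=(\iota\otimes\Delta)\circ\Delta$ and both $\{(b\otimes I)\Delta(c): b,c\in\mathcal A\}$ and $\{(I\otimes b)\Delta(c): b,c\in\mathcal A\}$ span dense subspaces of $\mathcal A\otimes\mathcal A$. A compact quantum subgroup of $G$ is a pair $K=(\mathcal A',\Delta')$, with $\mathcal A'$ a unital $C^*$-algebra and $\Delta':\mathcal A'\to\mathcal A'\otimes\mathcal A'$ a unital $^*$-homomorphism, together with a surjective unital $^*$-homomorphism $\pi:\mathcal A\to\mathcal A'$ such that $(\pi\otimes\pi)\circ\Delta=\Delta'\circ\pi$. Its right coset space is the $C^*$-algebra $\mathcal A^{\delta'_K}=\{a\in\mathcal A:(\pi\otimes\iota)(\Delta(a))=I\otimes a\}$, on which $G$ acts by the restriction $\eta'$ of $\Delta$. An action of $G$ on a unital $C^*$-algebra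 $\mathcal C$ is a unital $^*$-homomorphism $\delta:\mathcal C\to\mathcal C\otimes\mathcal A$ with $(\delta\otimes\iota)\circ\delta=(\iota\otimes\Delta)\circ\delta$; it is faithful if $\delta$ is injective. An everywhere defined counit of $G$ is a unital $^*$-homomorphism $e:\mathcal A\to\mathbb C$ with $(\iota\otimes e)(\Delta(a))=a$ for all $a\in\mathcal A$. **Theorem.** Let $\delta:\mathcal C\to\mathcal C\otimes\mathcal A$ be an action of a compact quantum group $G=(\mathcal A,\Delta)$ on a unital $C^*$-algebra $\mathcal C$, let $\chi:\mathcal C\to\mathbb C$ be a character, and let $T_\chi:=(\chi\otimes\iota)\circ\delta:\mathcal C\to\mathcal A$. Then there is a compact quantum subgroup $G_\chi=(\mathcal A',\Delta')$ of $G$, itself a compact quantum group, whose quotient map $\pi:\mathcal A\to\mathcal A'$ has as kernel the closed two-sided ideal of $\mathcal A$ generated by $\{T_\chi(c)-\chi(c)I: c\in\mathcal C\}$, such that: 1. $T_\chi$ is a $^*$-homomorphism of $\mathcal C$ into the right coset space $\mathcal A^{\delta'_{G_\chi}}$ and intertwines the actions of $G$: $\eta'\circ T_\chi=(T_\chi\otimes\iota)\circ\delta$;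 2. $\pi(T_\chi(c))=\chi(c)I_{\mathcal A'}$ for all $c\in\mathcal C$. Moreover, if $\delta$ is faithful and $G$ has an everywhere defined counit $e$, then $e(T_\chi(c))=\chi(c)$ for all $c\in\mathcal C$. -/

import Mathlib

universe u

namespace CQG

open scoped TensorProduct InnerProductSpace
open UniformSpace

/-- The Hilbert space tensor product: the completion of the algebraic tensor product of two inner
product spaces. -/
def HilbertTensor (H K : Type u) [NormedAddCommGroup H] [InnerProductSpace ℂ H]
    [NormedAddCommGroup K] [InnerProductSpace ℂ K] : Type u :=
  Completion (H ⊗[ℂ] K)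

section Operators

variable {H K : Type u} [NormedAddCommGroup H] [InnerProductSpace ℂ H]
  [NormedAddCommGroup K] [InnerProductSpace ℂ K]

noncomputable instance : NormedAddCommGroup (HilbertTensor H K) :=
  inferInstanceAs (NormedAddCommGroup (Completion (H ⊗[ℂ] K)))

noncomputable instance : InnerProductSpace ℂ (HilbertTensor H K) :=
  inferInstanceAs (InnerProductSpace ℂ (Completion (H ⊗[ℂ] K)))

instance : CompleteSpace (HilbertTensor H K) :=
  inferInstanceAs (CompleteSpace (Completion (H ⊗[ℂ] K)))

/-- The inclusion of the algebraic tensor product into the Hilbert space tensor product. -/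
noncomputable def toHilbert : H ⊗[ℂ] K →ₗᵢ[ℂ] HilbertTensor H K :=
  (Completion.toComplₗᵢ : H ⊗[ℂ] K →ₗᵢ[ℂ] Completion (H ⊗[ℂ] K))

theorem denseRange_toHilbert : DenseRange (toHilbert : H ⊗[ℂ] K → HilbertTensor H K) :=
  Completion.denseRange_coe

theorem HilbertTensor.induction {p : HilbertTensor H K → Prop} (x : HilbertTensor H K)
    (hp : IsClosed {x | p x}) (ih : ∀ x : H ⊗[ℂ] K, p (toHilbert x)) : p x :=
  isClosed_property denseRange_toHilbert hp ih x

/-- The operator `S ⊗ T` on the Hilbert space tensor product. -/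
noncomputable def opTensor (S : H →L[ℂ] H) (T : K →L[ℂ] K) :
    HilbertTensor H K →L[ℂ] HilbertTensor H K :=
  (TensorProduct.mapL S T).completion

theorem opTensor_coe (S : H →L[ℂ] H) (T : K →L[ℂ] K) (x : H ⊗[ℂ] K) :
    opTensor S T (toHilbert x) = toHilbert (TensorProduct.mapL S T x) :=
  ContinuousLinearMap.completion_apply_coe _ _

theorem hilbertTensor_ext {S T : HilbertTensor H K →L[ℂ] HilbertTensor H K}
    (h : ∀ x : H ⊗[ℂ] K, S (toHilbert x) = T (toHilbert x)) : S = T := by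
  ext x
  exact HilbertTensor.induction x (isClosed_eq S.continuous T.continuous) h

theorem opTensor_one : opTensor (1 : H →L[ℂ] H) (1 : K →L[ℂ] K) = 1 :=
  hilbertTensor_ext fun x => by
    rw [opTensor_coe]; exact congrArg _ (congrArg (fun f => f x) TensorProduct.mapL_id_id)

theorem opTensor_mul (S S' : H →L[ℂ] H) (T T' : K →L[ℂ] K) :
    opTensor (S * S') (T * T') = opTensor S T * opTensor S' T' :=
  hilbertTensor_ext fun x => by
    rw [mul_apply_eq_comp, opTensor_coe, opTensor_coe, opTensor_coe,
      TensorProduct.mapL_mul]; rfl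

theorem opTensor_add_left (S S' : H →L[ℂ] H) (T : K →L[ℂ] K) :
    opTensor (S + S') T = opTensor S T + opTensor S' T :=
  hilbertTensor_ext fun x => by
    rw [add_apply, opTensor_coe, opTensor_coe, opTensor_coe,
      TensorProduct.mapL_add_left, add_apply, map_add]

theorem opTensor_add_right (S : H →L[ℂ] H) (T T' : K →L[ℂ] K) :
    opTensor S (T + T') = opTensor S T + opTensor S T' :=
  hilbertTensor_ext fun x => by
    rw [add_apply, opTensor_coe, opTensor_coe, opTensor_coe,
      TensorProduct.mapL_add_right, add_apply, map_add]

theorem opTensor_smul_left (r : ℂ) (S : H →L[ℂ] H) (T : K →L[ℂ] K) :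
    opTensor (r • S) T = r • opTensor S T :=
  hilbertTensor_ext fun x => by
    rw [smul_apply, opTensor_coe, opTensor_coe,
      TensorProduct.mapL_smul_left, smul_apply, map_smul]

theorem opTensor_smul_right (r : ℂ) (S : H →L[ℂ] H) (T : K →L[ℂ] K) :
    opTensor S (r • T) = r • opTensor S T :=
  hilbertTensor_ext fun x => by
    rw [smul_apply, opTensor_coe, opTensor_coe,
      TensorProduct.mapL_smul_right, smul_apply, map_smul]

theorem norm_opTensor_le (S : H →L[ℂ] H) (T : K →L[ℂ] K) : ‖opTensor S T‖ ≤ ‖S‖ * ‖T‖ := by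
  refine ContinuousLinearMap.opNorm_le_bound _ (by positivity) fun x => ?_
  induction x using HilbertTensor.induction with
  | hp => apply isClosed_le <;> fun_prop
  | ih x =>
    rw [opTensor_coe, LinearIsometry.norm_map, LinearIsometry.norm_map]
    exact (TensorProduct.mapL S T).le_of_opNorm_le (TensorProduct.norm_mapL_le S T) x

variable [CompleteSpace H] [CompleteSpace K]

theorem inner_mapL_left (S : H →L[ℂ] H) (T : K →L[ℂ] K) (x y : H ⊗[ℂ] K) :
    ⟪TensorProduct.mapL (star S) (star T) x, y⟫_ℂ = ⟪x, TensorProduct.mapL S T y⟫_ℂ := by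
  induction x using TensorProduct.induction_on with
  | zero => simp
  | add x x' hx hx' => simp only [map_add, inner_add_left, hx, hx']
  | tmul h k =>
    induction y using TensorProduct.induction_on with
    | zero => simp
    | add y y' hy hy' => simp only [map_add, inner_add_right, hy, hy']
    | tmul h' k' =>
      simp [ContinuousLinearMap.star_eq_adjoint, ContinuousLinearMap.adjoint_inner_left]

theorem opTensor_star (S : H →L[ℂ] H) (T : K →L[ℂ] K) :
    opTensor (star S) (star T) = star (opTensor S T) := by
  rw [ContinuousLinearMap.star_eq_adjoint (opTensor S T), ContinuousLinearMap.eq_adjoint_iff]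
  intro x y
  induction x using HilbertTensor.induction with
  | hp => apply isClosed_eq <;> fun_prop
  | ih x =>
    induction y using HilbertTensor.induction with
    | hp => apply isClosed_eq <;> fun_prop
    | ih y =>
      rw [opTensor_coe, opTensor_coe, LinearIsometry.inner_map_map, LinearIsometry.inner_map_map,
        inner_mapL_left]

end Operators

section ProductRep

variable {A B : Type u} [CStarAlgebra A] [CStarAlgebra B]
variable {H K : Type u} [NormedAddCommGroup H] [InnerProductSpace ℂ H] [CompleteSpace H]
  [NormedAddCommGroup K] [InnerProductSpace ℂ K] [CompleteSpace K]

/-- The product representation `a ⊗ b ↦ ρ a ⊗ σ b` of the algebraic tensor product. -/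
noncomputable def algProdRep (ρ : A →⋆ₐ[ℂ] (H →L[ℂ] H)) (σ : B →⋆ₐ[ℂ] (K →L[ℂ] K)) :
    A ⊗[ℂ] B →⋆ₐ[ℂ] (HilbertTensor H K →L[ℂ] HilbertTensor H K) :=
  let L : A ⊗[ℂ] B →ₗ[ℂ] (HilbertTensor H K →L[ℂ] HilbertTensor H K) :=
    TensorProduct.lift (LinearMap.mk₂ ℂ (fun a b => opTensor (ρ a) (σ b))
      (fun a a' b => by rw [map_add, opTensor_add_left])
      (fun r a b => by rw [map_smul, opTensor_smul_left])
      (fun a b b' => by rw [map_add, opTensor_add_right])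
      (fun r a b => by rw [map_smul, opTensor_smul_right]))
  have hL : ∀ a b, L (a ⊗ₜ b) = opTensor (ρ a) (σ b) := fun _ _ => rfl
  { Algebra.TensorProduct.algHomOfLinearMapTensorProduct L
      (fun a a' b b' => by rw [hL, hL, hL, map_mul, map_mul, opTensor_mul])
      (by rw [hL, map_one, map_one, opTensor_one]) with
    map_star' := fun x => by
      change L (star x) = star (L x)
      induction x using TensorProduct.induction_on with
      | zero => rw [star_zero, map_zero, star_zero]
      | add x y hx hy => rw [star_add, map_add, map_add, hx, hy, star_add]
      | tmul a b => rw [TensorProduct.star_tmul, hL, hL, map_star, map_star, opTensor_star] }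

theorem algProdRep_tmul (ρ : A →⋆ₐ[ℂ] (H →L[ℂ] H)) (σ : B →⋆ₐ[ℂ] (K →L[ℂ] K)) (a : A) (b : B) :
    algProdRep ρ σ (a ⊗ₜ b) = opTensor (ρ a) (σ b) := rfl


/-- The unital `*`-representations of `A` on Hilbert spaces (in the universe of `A`, which contains
the universal representation of `A`). -/
structure Rep (A : Type u) [CStarAlgebra A] where
  H : Type u
  [normed : NormedAddCommGroup H]
  [innerProd : InnerProductSpace ℂ H]
  [complete : CompleteSpace H]
  hom : A →⋆ₐ[ℂ] (H →L[ℂ] H)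

attribute [instance] Rep.normed Rep.innerProd Rep.complete

theorem algProdRep_bdd (t : A ⊗[ℂ] B) :
    BddAbove (Set.range fun p : Rep A × Rep B => ‖algProdRep p.1.hom p.2.hom t‖) := by
  induction t using TensorProduct.induction_on with
  | zero => exact ⟨0, by rintro _ ⟨p, rfl⟩; simp⟩
  | add x y hx hy =>
    obtain ⟨M, hM⟩ := hx
    obtain ⟨N, hN⟩ := hy
    refine ⟨M + N, ?_⟩
    rintro _ ⟨p, rfl⟩
    simp only [map_add]
    exact (norm_add_le _ _).trans (add_le_add (hM ⟨p, rfl⟩) (hN ⟨p, rfl⟩))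
  | tmul a b =>
    refine ⟨‖a‖ * ‖b‖, ?_⟩
    rintro _ ⟨p, rfl⟩
    simp only [algProdRep_tmul]
    exact (norm_opTensor_le _ _).trans (mul_le_mul (NonUnitalStarAlgHom.norm_apply_le _ a)
      (NonUnitalStarAlgHom.norm_apply_le _ b) (norm_nonneg _) (norm_nonneg _))

/-- The spatial (minimal) `C*`-norm on the algebraic tensor product: the supremum of the norms in
all product representations. It is attained at the product of the universal representations. -/
noncomputable def spatialNorm (t : A ⊗[ℂ] B) : ℝ :=
  ⨆ p : Rep A × Rep B, ‖algProdRep p.1.hom p.2.hom t‖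

/-- The representation on the zero Hilbert space. -/
noncomputable def Rep.zero (A : Type u) [CStarAlgebra A] : Rep A where
  H := PUnit.{u+1}
  hom :=
    { toFun := fun _ => 0
      map_one' := Subsingleton.elim _ _
      map_mul' := fun _ _ => Subsingleton.elim _ _
      map_zero' := rfl
      map_add' := fun _ _ => Subsingleton.elim _ _
      commutes' := fun _ => Subsingleton.elim _ _
      map_star' := fun _ => Subsingleton.elim _ _ }

noncomputable instance : Inhabited (Rep A) := ⟨Rep.zero A⟩

theorem norm_algProdRep_le (t : A ⊗[ℂ] B) (ρ : Rep A) (σ : Rep B) :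
    ‖algProdRep ρ.hom σ.hom t‖ ≤ spatialNorm t :=
  le_ciSup (algProdRep_bdd t) (ρ, σ)

theorem spatialNorm_le (t : A ⊗[ℂ] B) {M : ℝ}
    (h : ∀ (ρ : Rep A) (σ : Rep B), ‖algProdRep ρ.hom σ.hom t‖ ≤ M) : spatialNorm t ≤ M :=
  ciSup_le fun p => h p.1 p.2

theorem spatialNorm_nonneg (t : A ⊗[ℂ] B) : 0 ≤ spatialNorm t :=
  Real.iSup_nonneg fun _ => norm_nonneg _

end ProductRep

section GelfandNaimark

open scoped ComplexStarModule ComplexOrder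

theorem exists_positive_functional {A : Type u} [CStarAlgebra A] [PartialOrder A]
    [StarOrderedRing A] (b : A) (hb : 0 ≤ b) (hb0 : b ≠ 0) :
    ∃ f : A →ₚ[ℂ] ℂ, f 1 = 1 ∧ f b = ‖b‖ := by
  have : Nontrivial A := ⟨b, 0, hb0⟩
  have hbn : 0 < ‖b‖ := norm_pos_iff.mpr hb0
  have hn : ‖algebraMap ℝ A ‖b‖ + b‖ = 2 * ‖b‖ := by
    apply le_antisymm
    · refine (norm_add_le _ _).trans ?_
      rw [norm_algebraMap', norm_norm, two_mul]
    · have h := CStarAlgebra.norm_mem_spectrum_of_nonneg hb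
      have h2 : ‖b‖ + ‖b‖ ∈ spectrum ℝ (algebraMap ℝ A ‖b‖ + b) :=
        spectrum.add_mem_iff.mpr (by simpa using h)
      have := spectrum.norm_le_norm_of_mem h2
      rw [Real.norm_of_nonneg (by positivity)] at this
      linarith
  obtain ⟨g, hg, hgv⟩ := exists_dual_vector'' ℝ (algebraMap ℝ A ‖b‖ + b)
  have hle : ∀ x, g x ≤ ‖x‖ := fun x => (le_abs_self _).trans (by
    simpa using g.le_of_opNorm_le hg x)
  have h1 : g 1 ≤ 1 := by simpa using hle 1
  have h2 : g b ≤ ‖b‖ := hle b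
  have h3 : ‖b‖ * g 1 + g b = 2 * ‖b‖ := by
    rw [hn, map_add, Algebra.algebraMap_eq_smul_one, map_smul] at hgv
    simpa using hgv
  have hg1 : g 1 = 1 := by nlinarith
  have hgb : g b = ‖b‖ := by rw [hg1] at h3; linarith
  have hpos : ∀ x : A, 0 ≤ x → 0 ≤ g x := by
    intro x hx
    have hx1 : x ≤ algebraMap ℝ A ‖x‖ := IsSelfAdjoint.le_algebraMap_norm_self (.of_nonneg hx)
    have h4 : ‖algebraMap ℝ A ‖x‖ - x‖ ≤ ‖algebraMap ℝ A ‖x‖‖ :=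
      CStarAlgebra.norm_le_norm_of_nonneg_of_le (sub_nonneg.mpr hx1) (sub_le_self _ hx)
    rw [norm_algebraMap', norm_norm] at h4
    have h5 := (hle _).trans h4
    rw [map_sub, Algebra.algebraMap_eq_smul_one, map_smul, hg1, smul_eq_mul, mul_one] at h5
    linarith
  let f₀ : A →ₗ[ℂ] ℂ :=
    { toFun := fun x => (g (ℜ x : A) : ℂ) + Complex.I * (g (ℑ x : A) : ℂ)
      map_add' := fun x y => by simp; ring
      map_smul' := fun r x => by
        simp [realPart_smul, imaginaryPart_smul]
        apply Complex.ext <;> simp }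
  have hf : ∀ x : A, IsSelfAdjoint x → f₀ x = (g x : ℂ) := fun x hx => by
    simp [f₀, hx.coe_realPart, hx.imaginaryPart]
  refine ⟨PositiveLinearMap.mk₀ f₀ fun x hx => ?_, ?_, ?_⟩
  · rw [hf x (.of_nonneg hx)]
    exact_mod_cast hpos x hx
  · exact (hf 1 (.one _)).trans (by rw [hg1]; simp)
  · exact (hf b (.of_nonneg hb)).trans (by rw [hgb])

/-- Every element of a `C*`-algebra attains its norm in some representation. -/
theorem exists_rep_norm_le {A : Type u} [CStarAlgebra A] (a : A) :
    ∃ ρ : Rep A, ‖a‖ ≤ ‖ρ.hom a‖ := by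
  rcases eq_or_ne a 0 with rfl | ha
  · exact ⟨default, by simp⟩
  let _ : PartialOrder A := CStarAlgebra.spectralOrder A
  have _ : StarOrderedRing A := CStarAlgebra.spectralOrderedRing A
  obtain ⟨f, hf1, hfa⟩ := exists_positive_functional (star a * a) (star_mul_self_nonneg a)
    (by simpa using ha)
  refine ⟨⟨f.GNS, f.gnsStarAlgHom⟩, ?_⟩
  have h1 : ‖((f.toPreGNS 1 : f.PreGNS) : f.GNS)‖ = 1 := by
    rw [Completion.norm_coe, PositiveLinearMap.preGNS_norm_def]
    simp [hf1]
  have h2 : ‖f.gnsStarAlgHom a ((f.toPreGNS 1 : f.PreGNS) : f.GNS)‖ = ‖a‖ := by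
    have : f.gnsStarAlgHom a ((f.toPreGNS 1 : f.PreGNS) : f.GNS) =
        ((f.toPreGNS a : f.PreGNS) : f.GNS) := by
      simp
    rw [this, Completion.norm_coe, PositiveLinearMap.preGNS_norm_def]
    simp only [PositiveLinearMap.ofPreGNS_toPreGNS]
    rw [hfa, CStarRing.norm_star_mul_self, Complex.ofReal_re, Real.sqrt_mul_self (norm_nonneg a)]
  calc ‖a‖ = ‖f.gnsStarAlgHom a ((f.toPreGNS 1 : f.PreGNS) : f.GNS)‖ := h2.symm
    _ ≤ ‖f.gnsStarAlgHom a‖ * ‖((f.toPreGNS 1 : f.PreGNS) : f.GNS)‖ :=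
      ContinuousLinearMap.le_opNorm _ _
    _ = ‖f.gnsStarAlgHom a‖ := by rw [h1, mul_one]

end GelfandNaimark

/-- The algebraic tensor product, to be equipped with the spatial norm. -/
def AlgTensor (A B : Type u) [CStarAlgebra A] [CStarAlgebra B] : Type u := A ⊗[ℂ] B

namespace AlgTensor

variable {A B : Type u} [CStarAlgebra A] [CStarAlgebra B]

noncomputable instance : Ring (AlgTensor A B) := inferInstanceAs (Ring (A ⊗[ℂ] B))
noncomputable instance : Algebra ℂ (AlgTensor A B) := inferInstanceAs (Algebra ℂ (A ⊗[ℂ] B))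
noncomputable instance : StarRing (AlgTensor A B) := inferInstanceAs (StarRing (A ⊗[ℂ] B))
instance : StarModule ℂ (AlgTensor A B) := inferInstanceAs (StarModule ℂ (A ⊗[ℂ] B))

/-- The identity map onto the algebraic tensor product. -/
noncomputable def equiv : A ⊗[ℂ] B ≃⋆ₐ[ℂ] AlgTensor A B := StarAlgEquiv.refl ℂ (A ⊗[ℂ] B)

noncomputable instance : Norm (AlgTensor A B) := ⟨fun t => spatialNorm (equiv.symm t)⟩

theorem norm_def (t : AlgTensor A B) : ‖t‖ = spatialNorm (equiv.symm t) := rfl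

noncomputable instance : SeminormedRing (AlgTensor A B) :=
  { (inferInstance : Ring (AlgTensor A B)),
    SeminormedAddCommGroup.ofCore (𝕜 := ℂ) (E := AlgTensor A B)
      { norm_nonneg := fun t => spatialNorm_nonneg _
        norm_smul := fun r t => by
          rw [norm_def, norm_def, map_smul, spatialNorm, spatialNorm,
            Real.mul_iSup_of_nonneg (norm_nonneg r)]
          exact iSup_congr fun p => by rw [map_smul, norm_smul]
        norm_triangle := fun s t => spatialNorm_le _ fun ρ σ => by
          rw [map_add, map_add]
          exact (norm_add_le _ _).trans
            (add_le_add (norm_algProdRep_le _ ρ σ) (norm_algProdRep_le _ ρ σ)) } with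
    norm_mul_le := fun s t => spatialNorm_le _ fun ρ σ => by
      rw [map_mul, map_mul]
      exact (norm_mul_le _ _).trans
        (mul_le_mul (norm_algProdRep_le _ ρ σ) (norm_algProdRep_le _ ρ σ) (norm_nonneg _)
          (spatialNorm_nonneg _)) }

noncomputable instance : NormedAlgebra ℂ (AlgTensor A B) where
  norm_smul_le r t := by
    rw [norm_def, norm_def]
    exact spatialNorm_le _ fun ρ σ => by
      rw [map_smul, map_smul, norm_smul]
      exact mul_le_mul_of_nonneg_left (norm_algProdRep_le _ ρ σ) (norm_nonneg r)

theorem norm_star' (t : AlgTensor A B) : ‖star t‖ = ‖t‖ := by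
  rw [norm_def, norm_def, spatialNorm, spatialNorm]
  exact iSup_congr fun p => by rw [map_star, map_star, norm_star]

theorem norm_star_mul_self' (t : AlgTensor A B) : ‖t‖ * ‖t‖ ≤ ‖star t * t‖ := by
  have h : ‖t‖ ≤ √‖star t * t‖ := spatialNorm_le _ fun ρ σ => by
    refine Real.le_sqrt_of_sq_le ?_
    rw [sq, ← CStarRing.norm_star_mul_self, ← map_star, ← map_star, ← map_mul, ← map_mul]
    exact norm_algProdRep_le _ ρ σ
  calc ‖t‖ * ‖t‖ ≤ √‖star t * t‖ * √‖star t * t‖ :=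
        mul_le_mul h h (norm_nonneg _) (Real.sqrt_nonneg _)
    _ = ‖star t * t‖ := Real.mul_self_sqrt (norm_nonneg _)

instance : NormedStarGroup (AlgTensor A B) := ⟨fun t => (norm_star' t).le⟩

end AlgTensor

/-- The spatial (minimal) tensor product of two unital `C*`-algebras. -/
def SpatialTensor (A B : Type u) [CStarAlgebra A] [CStarAlgebra B] : Type u :=
  Completion (AlgTensor A B)

namespace SpatialTensor

variable {A B : Type u} [CStarAlgebra A] [CStarAlgebra B]

noncomputable instance : NormedRing (SpatialTensor A B) :=
  inferInstanceAs (NormedRing (Completion (AlgTensor A B)))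

noncomputable instance : Algebra ℂ (SpatialTensor A B) :=
  inferInstanceAs (Algebra ℂ (Completion (AlgTensor A B)))

noncomputable instance : NormedAlgebra ℂ (SpatialTensor A B) where
  norm_smul_le r x := norm_smul_le (β := Completion (AlgTensor A B)) r x

instance : CompleteSpace (SpatialTensor A B) :=
  inferInstanceAs (CompleteSpace (Completion (AlgTensor A B)))

/-- The canonical map of the algebraic tensor product into the spatial one, as a map. -/
noncomputable def coe (t : A ⊗[ℂ] B) : SpatialTensor A B :=
  ((AlgTensor.equiv t : AlgTensor A B) : Completion (AlgTensor A B))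

theorem denseRange_coe : DenseRange (coe : A ⊗[ℂ] B → SpatialTensor A B) :=
  Completion.denseRange_coe (α := AlgTensor A B)

theorem norm_coe (t : A ⊗[ℂ] B) : ‖coe t‖ = spatialNorm t := Completion.norm_coe _

theorem induction {p : SpatialTensor A B → Prop} (x : SpatialTensor A B)
    (hp : IsClosed {x | p x}) (ih : ∀ t : A ⊗[ℂ] B, p (coe t)) : p x :=
  isClosed_property denseRange_coe hp ih x

theorem coe_add (s t : A ⊗[ℂ] B) : coe (s + t) = coe s + coe t :=
  Completion.coe_add (AlgTensor.equiv s) (AlgTensor.equiv t)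

theorem coe_mul (s t : A ⊗[ℂ] B) : coe (s * t) = coe s * coe t :=
  Completion.coe_mul (AlgTensor.equiv s) (AlgTensor.equiv t)

theorem coe_one : coe (1 : A ⊗[ℂ] B) = 1 := Completion.coe_one (AlgTensor A B)

theorem coe_smul (r : ℂ) (t : A ⊗[ℂ] B) : coe (r • t) = r • coe t :=
  Completion.coe_smul r (AlgTensor.equiv t)

/-- The adjoint, extended by continuity. -/
noncomputable instance : Star (SpatialTensor A B) :=
  ⟨(Completion.map star : Completion (AlgTensor A B) → Completion (AlgTensor A B))⟩

theorem star_coe (t : A ⊗[ℂ] B) : star (coe t) = coe (star t) :=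
  Completion.map_coe (star_isometry (E := AlgTensor A B)).uniformContinuous (AlgTensor.equiv t)

theorem continuous_star' : Continuous (star : SpatialTensor A B → SpatialTensor A B) :=
  Completion.continuous_map (f := (star : AlgTensor A B → AlgTensor A B))

instance : ContinuousStar (SpatialTensor A B) := ⟨continuous_star'⟩

noncomputable instance : StarRing (SpatialTensor A B) where
  star_involutive x := by
    induction x using SpatialTensor.induction with
    | hp => apply isClosed_eq <;> fun_prop
    | ih t => rw [star_coe, star_coe, star_star]
  star_mul x y := by
    induction x using SpatialTensor.induction with
    | hp => apply isClosed_eq <;> fun_prop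
    | ih s =>
      induction y using SpatialTensor.induction with
      | hp => apply isClosed_eq <;> fun_prop
      | ih t => rw [← coe_mul, star_coe, star_coe, star_coe, star_mul, coe_mul]
  star_add x y := by
    induction x using SpatialTensor.induction with
    | hp => apply isClosed_eq <;> fun_prop
    | ih s =>
      induction y using SpatialTensor.induction with
      | hp => apply isClosed_eq <;> fun_prop
      | ih t => rw [← coe_add, star_coe, star_coe, star_coe, star_add, coe_add]

theorem star_smul' (r : ℂ) (x : SpatialTensor A B) : star (r • x) = star r • star x := by
  induction x using SpatialTensor.induction with
  | hp =>
    have h₁ : Continuous fun x : SpatialTensor A B => r • x := continuous_const_smul r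
    have h₂ : Continuous fun x : SpatialTensor A B => star r • x := continuous_const_smul (star r)
    exact isClosed_eq (continuous_star'.comp h₁) (h₂.comp continuous_star')
  | ih t =>
    have h : star (r • t) = star r • star t := star_smul r t
    rw [← coe_smul, star_coe, star_coe, h, coe_smul]

noncomputable instance : CStarAlgebra (SpatialTensor A B) where
  norm_mul_self_le x := by
    induction x using SpatialTensor.induction with
    | hp => apply isClosed_le <;> fun_prop
    | ih t =>
      rw [star_coe, ← coe_mul, norm_coe, norm_coe]
      exact AlgTensor.norm_star_mul_self' (AlgTensor.equiv t)
  star_smul := star_smul'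

/-- The canonical `*`-homomorphism of the algebraic tensor product into the spatial one. -/
noncomputable def of : A ⊗[ℂ] B →⋆ₐ[ℂ] SpatialTensor A B where
  toFun := coe
  map_one' := coe_one
  map_mul' := coe_mul
  map_zero' := by simpa using coe_smul (0 : ℂ) (0 : A ⊗[ℂ] B)
  map_add' := coe_add
  commutes' r := by
    rw [Algebra.algebraMap_eq_smul_one, coe_smul, coe_one, Algebra.algebraMap_eq_smul_one]
  map_star' t := (star_coe t).symm

/-- The elementary tensor `a ⊗ b`. -/
noncomputable def tmul (a : A) (b : B) : SpatialTensor A B := of (a ⊗ₜ[ℂ] b)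

/-- The extension by continuity of a `*`-homomorphism on the algebraic tensor product that is
contractive for the spatial norm. -/
noncomputable def lift {D : Type*} [CStarAlgebra D] (Φ : A ⊗[ℂ] B →⋆ₐ[ℂ] D)
    (h : ∀ t, ‖Φ t‖ ≤ spatialNorm t) : SpatialTensor A B →⋆ₐ[ℂ] D :=
  let L : AlgTensor A B →L[ℂ] D :=
    LinearMap.mkContinuous
      (Φ.toAlgHom.toLinearMap ∘ₗ (AlgTensor.equiv (A := A) (B := B)).symm.toAlgEquiv.toLinearMap)
      1 (fun t => by rw [one_mul]; exact h _)
  let F : SpatialTensor A B → D := (Completion.extension L : Completion (AlgTensor A B) → D)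
  have hF : ∀ t, F (coe t) = Φ t := fun t =>
    Completion.extension_coe L.uniformContinuous (AlgTensor.equiv t)
  have hc : Continuous F := Completion.continuous_extension (f := L)
  { toFun := F
    map_one' := by rw [← coe_one, hF, map_one]
    map_zero' := by
      have : (0 : SpatialTensor A B) = coe 0 := (map_zero of).symm
      rw [this, hF, map_zero]
    map_mul' := fun x y => by
      induction x using SpatialTensor.induction with
      | hp => apply isClosed_eq <;> fun_prop
      | ih s =>
        induction y using SpatialTensor.induction with
        | hp => apply isClosed_eq <;> fun_prop
        | ih t => rw [← coe_mul, hF, hF, hF, map_mul]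
    map_add' := fun x y => by
      induction x using SpatialTensor.induction with
      | hp => apply isClosed_eq <;> fun_prop
      | ih s =>
        induction y using SpatialTensor.induction with
        | hp => apply isClosed_eq <;> fun_prop
        | ih t => rw [← coe_add, hF, hF, hF, map_add]
    commutes' := fun r => by
      rw [Algebra.algebraMap_eq_smul_one, ← coe_one, ← coe_smul, hF, map_smul, map_one,
        Algebra.algebraMap_eq_smul_one]
    map_star' := fun x => by
      induction x using SpatialTensor.induction with
      | hp => apply isClosed_eq <;> fun_prop
      | ih t => rw [star_coe, hF, hF, map_star] }

theorem lift_of {D : Type*} [CStarAlgebra D] (Φ : A ⊗[ℂ] B →⋆ₐ[ℂ] D)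
    (h : ∀ t, ‖Φ t‖ ≤ spatialNorm t) (t : A ⊗[ℂ] B) : lift Φ h (of t) = Φ t :=
  Completion.extension_coe (f := LinearMap.mkContinuous
      (Φ.toAlgHom.toLinearMap ∘ₗ (AlgTensor.equiv (A := A) (B := B)).symm.toAlgEquiv.toLinearMap)
      1 (fun t => by rw [one_mul]; exact h _)) (ContinuousLinearMap.uniformContinuous _)
      (AlgTensor.equiv t)


/-- The representation `ρ ⊗ σ` of the spatial tensor product on the Hilbert space tensor product. -/
noncomputable def prodRep (ρ : Rep A) (σ : Rep B) : Rep (SpatialTensor A B) where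
  H := HilbertTensor ρ.H σ.H
  hom := lift (algProdRep ρ.hom σ.hom) fun t => norm_algProdRep_le t ρ σ

theorem prodRep_of (ρ : Rep A) (σ : Rep B) (t : A ⊗[ℂ] B) :
    (prodRep ρ σ).hom (of t) = algProdRep ρ.hom σ.hom t :=
  lift_of _ (fun t => norm_algProdRep_le t ρ σ) t

/-- The `*`-homomorphism `a ⊗ b ↦ f a * g b` on the algebraic tensor product, for unital
`*`-homomorphisms `f` and `g` with commuting ranges. -/
noncomputable def algLift {D : Type*} [CStarAlgebra D] (f : A →⋆ₐ[ℂ] D) (g : B →⋆ₐ[ℂ] D)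
    (h : ∀ a b, Commute (f a) (g b)) : A ⊗[ℂ] B →⋆ₐ[ℂ] D where
  __ := Algebra.TensorProduct.lift f.toAlgHom g.toAlgHom h
  map_star' x := by
    change Algebra.TensorProduct.lift f.toAlgHom g.toAlgHom h (star x) =
      star (Algebra.TensorProduct.lift f.toAlgHom g.toAlgHom h x)
    induction x using TensorProduct.induction_on with
    | zero => rw [star_zero, map_zero, star_zero]
    | add x y hx hy => rw [star_add, map_add, map_add, hx, hy, star_add]
    | tmul a b =>
      rw [TensorProduct.star_tmul, Algebra.TensorProduct.lift_tmul,
        Algebra.TensorProduct.lift_tmul, star_mul]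
      change f (star a) * g (star b) = star (g b) * star (f a)
      rw [← map_star, ← map_star]
      exact h _ _

theorem algLift_tmul {D : Type*} [CStarAlgebra D] (f : A →⋆ₐ[ℂ] D) (g : B →⋆ₐ[ℂ] D)
    (h : ∀ a b, Commute (f a) (g b)) (a : A) (b : B) : algLift f g h (a ⊗ₜ b) = f a * g b :=
  Algebra.TensorProduct.lift_tmul f.toAlgHom g.toAlgHom h a b

theorem tmul_mul_tmul (a a' : A) (b b' : B) :
    tmul a b * tmul a' b' = tmul (a * a') (b * b') := by
  rw [tmul, tmul, tmul, ← map_mul, Algebra.TensorProduct.tmul_mul_tmul]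

/-- The embedding `a ↦ a ⊗ I`. -/
noncomputable def inl : A →⋆ₐ[ℂ] SpatialTensor A B where
  __ := (of (A := A) (B := B)).toAlgHom.comp Algebra.TensorProduct.includeLeft
  map_star' a := by
    change of (star a ⊗ₜ[ℂ] (1 : B)) = star (of (a ⊗ₜ[ℂ] (1 : B)))
    rw [← map_star, TensorProduct.star_tmul, star_one]

/-- The embedding `b ↦ I ⊗ b`. -/
noncomputable def inr : B →⋆ₐ[ℂ] SpatialTensor A B where
  __ := (of (A := A) (B := B)).toAlgHom.comp Algebra.TensorProduct.includeRight
  map_star' b := by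
    change of ((1 : A) ⊗ₜ[ℂ] star b) = star (of ((1 : A) ⊗ₜ[ℂ] b))
    rw [← map_star, TensorProduct.star_tmul, star_one]

theorem inl_apply (a : A) : (inl a : SpatialTensor A B) = tmul a 1 := rfl

theorem inr_apply (b : B) : (inr b : SpatialTensor A B) = tmul 1 b := rfl

section Map

variable {A' B' : Type u} [CStarAlgebra A'] [CStarAlgebra B']
  (f : A →⋆ₐ[ℂ] A') (g : B →⋆ₐ[ℂ] B')

theorem commute_inl_inr (a : A) (b : B) :
    Commute (inl a : SpatialTensor A B) (inr b : SpatialTensor A B) := by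
  rw [Commute, SemiconjBy, inl_apply, inr_apply, tmul_mul_tmul, tmul_mul_tmul]
  simp

theorem commute_comp (a : A) (b : B) :
    Commute ((inl.comp f : A →⋆ₐ[ℂ] SpatialTensor A' B') a)
      ((inr.comp g : B →⋆ₐ[ℂ] SpatialTensor A' B') b) :=
  commute_inl_inr (f a) (g b)

theorem algLift_eq_of_map (t : A ⊗[ℂ] B) :
    algLift (inl.comp f) (inr.comp g) (commute_comp f g) t =
      (of (TensorProduct.map f.toAlgHom.toLinearMap g.toAlgHom.toLinearMap t) :
        SpatialTensor A' B') := by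
  induction t using TensorProduct.induction_on with
  | zero => simp
  | add x y hx hy => rw [map_add, hx, hy, map_add, map_add]
  | tmul a b =>
    rw [algLift_tmul, StarAlgHom.comp_apply, StarAlgHom.comp_apply, inl_apply, inr_apply,
      tmul_mul_tmul, mul_one, one_mul]
    rfl

/-- Pull-back of a representation along a unital `*`-homomorphism. -/
noncomputable def _root_.CQG.Rep.comp (ρ : Rep A') (f : A →⋆ₐ[ℂ] A') : Rep A :=
  ⟨ρ.H, ρ.hom.comp f⟩

theorem algProdRep_map (ρ : Rep A') (σ : Rep B') (t : A ⊗[ℂ] B) :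
    algProdRep ρ.hom σ.hom (TensorProduct.map f.toAlgHom.toLinearMap g.toAlgHom.toLinearMap t) =
      algProdRep (ρ.hom.comp f) (σ.hom.comp g) t := by
  induction t using TensorProduct.induction_on with
  | zero => simp
  | add x y hx hy => rw [map_add, map_add, hx, hy, map_add]
  | tmul a b => rfl

/-- The tensor product `f ⊗ g` of two unital `*`-homomorphisms. -/
noncomputable def map : SpatialTensor A B →⋆ₐ[ℂ] SpatialTensor A' B' :=
  lift (algLift (inl.comp f) (inr.comp g) (commute_comp f g)) fun t => by
    rw [algLift_eq_of_map]
    refine (norm_coe _).trans_le (spatialNorm_le _ fun ρ σ => ?_)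
    rw [algProdRep_map]
    exact norm_algProdRep_le t (ρ.comp f) (σ.comp g)

theorem map_tmul (a : A) (b : B) : map f g (tmul a b) = tmul (f a) (g b) := by
  rw [map, tmul, lift_of, algLift_eq_of_map]
  rfl

end Map

section Slice

/-- The scalar representation `a ↦ χ a • I`. -/
noncomputable def scalarHom (χ : A →⋆ₐ[ℂ] ℂ) (D : Type*) [CStarAlgebra D] : A →⋆ₐ[ℂ] D :=
  (StarAlgHom.ofId ℂ D).comp χ

theorem scalarHom_apply (χ : A →⋆ₐ[ℂ] ℂ) (D : Type*) [CStarAlgebra D] (a : A) :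
    scalarHom χ D a = χ a • (1 : D) :=
  Algebra.algebraMap_eq_smul_one (χ a)

theorem starId_apply (a : A) : StarAlgHom.id ℂ A a = a := rfl

theorem commute_scalarHom (χ : A →⋆ₐ[ℂ] ℂ) (a : A) (b : B) :
    Commute (scalarHom χ B a) (StarAlgHom.id ℂ B b) :=
  Algebra.commutes (χ a) b

theorem norm_le_norm_opTensor_one_left {H : Type u} [NormedAddCommGroup H]
    [InnerProductSpace ℂ H] (S : H →L[ℂ] H) : ‖S‖ ≤ ‖opTensor (1 : H →L[ℂ] H) S‖ := by
  refine ContinuousLinearMap.opNorm_le_bound _ (norm_nonneg _) fun ξ => ?_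
  rcases eq_or_ne ξ 0 with rfl | hξ
  · simp
  have h := (opTensor (1 : H →L[ℂ] H) S).le_opNorm (toHilbert (ξ ⊗ₜ[ℂ] ξ))
  rw [opTensor_coe, LinearIsometry.norm_map, LinearIsometry.norm_map, TensorProduct.mapL_tmul,
    TensorProduct.norm_tmul, TensorProduct.norm_tmul, one_apply_eq_self] at h
  have := norm_pos_iff.mpr hξ
  nlinarith

theorem norm_le_norm_opTensor_one_right {H : Type u} [NormedAddCommGroup H]
    [InnerProductSpace ℂ H] (S : H →L[ℂ] H) : ‖S‖ ≤ ‖opTensor S (1 : H →L[ℂ] H)‖ := by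
  refine ContinuousLinearMap.opNorm_le_bound _ (norm_nonneg _) fun ξ => ?_
  rcases eq_or_ne ξ 0 with rfl | hξ
  · simp
  have h := (opTensor S (1 : H →L[ℂ] H)).le_opNorm (toHilbert (ξ ⊗ₜ[ℂ] ξ))
  rw [opTensor_coe, LinearIsometry.norm_map, LinearIsometry.norm_map, TensorProduct.mapL_tmul,
    TensorProduct.norm_tmul, TensorProduct.norm_tmul, one_apply_eq_self] at h
  have := norm_pos_iff.mpr hξ
  nlinarith

theorem algProdRep_scalar_left (χ : A →⋆ₐ[ℂ] ℂ) (t : A ⊗[ℂ] B) (ρ : Rep B) :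
    algProdRep (scalarHom χ (ρ.H →L[ℂ] ρ.H)) ρ.hom t =
      opTensor 1 (ρ.hom (algLift (scalarHom χ B) (StarAlgHom.id ℂ B) (commute_scalarHom χ) t)) := by
  induction t using TensorProduct.induction_on with
  | zero => simpa using (opTensor_smul_right (0 : ℂ) (1 : ρ.H →L[ℂ] ρ.H) (0 : ρ.H →L[ℂ] ρ.H)).symm
  | add x y hx hy => rw [map_add, hx, hy, map_add, map_add, opTensor_add_right]
  | tmul a b =>
    rw [algProdRep_tmul, algLift_tmul, scalarHom_apply, scalarHom_apply, starId_apply,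
      smul_one_mul, map_smul, opTensor_smul_right, opTensor_smul_left]

/-- The slice map `χ ⊗ ι`, `a ⊗ b ↦ χ a • b`. -/
noncomputable def sliceLeft (χ : A →⋆ₐ[ℂ] ℂ) : SpatialTensor A B →⋆ₐ[ℂ] B :=
  lift (algLift (scalarHom χ B) (StarAlgHom.id ℂ B) (commute_scalarHom χ)) fun t => by
    obtain ⟨ρ, hρ⟩ := exists_rep_norm_le
      (algLift (scalarHom χ B) (StarAlgHom.id ℂ B) (commute_scalarHom χ) t)
    refine hρ.trans ((norm_le_norm_opTensor_one_left _).trans ?_)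
    rw [← algProdRep_scalar_left]
    exact norm_algProdRep_le t ⟨ρ.H, scalarHom χ (ρ.H →L[ℂ] ρ.H)⟩ ρ

theorem sliceLeft_tmul (χ : A →⋆ₐ[ℂ] ℂ) (a : A) (b : B) : sliceLeft χ (tmul a b) = χ a • b := by
  rw [sliceLeft, tmul, lift_of, algLift_tmul, scalarHom_apply, starId_apply, smul_one_mul]

theorem algProdRep_scalar_right (χ : B →⋆ₐ[ℂ] ℂ) (t : A ⊗[ℂ] B) (ρ : Rep A) :
    algProdRep ρ.hom (scalarHom χ (ρ.H →L[ℂ] ρ.H)) t =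
      opTensor (ρ.hom (algLift (StarAlgHom.id ℂ A) (scalarHom χ A)
        (fun a b => (commute_scalarHom χ b a).symm) t)) 1 := by
  induction t using TensorProduct.induction_on with
  | zero => simpa using (opTensor_smul_left (0 : ℂ) (0 : ρ.H →L[ℂ] ρ.H) (1 : ρ.H →L[ℂ] ρ.H)).symm
  | add x y hx hy => rw [map_add, hx, hy, map_add, map_add, opTensor_add_left]
  | tmul a b =>
    rw [algProdRep_tmul, algLift_tmul, scalarHom_apply, scalarHom_apply, starId_apply,
      mul_smul_one, map_smul, opTensor_smul_left, opTensor_smul_right]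

/-- The slice map `ι ⊗ χ`, `a ⊗ b ↦ χ b • a`. -/
noncomputable def sliceRight (χ : B →⋆ₐ[ℂ] ℂ) : SpatialTensor A B →⋆ₐ[ℂ] A :=
  lift (algLift (StarAlgHom.id ℂ A) (scalarHom χ A)
    (fun a b => (commute_scalarHom χ b a).symm)) fun t => by
    obtain ⟨ρ, hρ⟩ := exists_rep_norm_le (algLift (StarAlgHom.id ℂ A) (scalarHom χ A)
      (fun a b => (commute_scalarHom χ b a).symm) t)
    refine hρ.trans ((norm_le_norm_opTensor_one_right _).trans ?_)
    rw [← algProdRep_scalar_right]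
    exact norm_algProdRep_le t ρ ⟨ρ.H, scalarHom χ (ρ.H →L[ℂ] ρ.H)⟩

theorem sliceRight_tmul (χ : B →⋆ₐ[ℂ] ℂ) (a : A) (b : B) : sliceRight χ (tmul a b) = χ b • a := by
  rw [sliceRight, tmul, lift_of, algLift_tmul, scalarHom_apply, starId_apply, mul_smul_one]

end Slice

end SpatialTensor

open SpatialTensor

/-- The canonical identification `(A ⊗ B) ⊗ C = A ⊗ (B ⊗ C)`, as a relation: `x` and `y` correspond
to each other if, for all representations `ρ`, `σ`, `τ` of `A`, `B`, `C` on Hilbert spaces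
`H`, `K`, `L`, the operators `((ρ ⊗ σ) ⊗ τ) x` and `(ρ ⊗ (σ ⊗ τ)) y` agree as operators on
`H ⊗ K ⊗ L`, which means that they have the same matrix coefficients between elementary tensors. -/
def SpatialTensor.AssocEq {A B C : Type u} [CStarAlgebra A] [CStarAlgebra B] [CStarAlgebra C]
    (x : SpatialTensor (SpatialTensor A B) C) (y : SpatialTensor A (SpatialTensor B C)) : Prop :=
  ∀ (ρ : Rep A) (σ : Rep B) (τ : Rep C) (h h' : ρ.H) (k k' : σ.H) (l l' : τ.H),
    ⟪toHilbert (toHilbert (h ⊗ₜ[ℂ] k) ⊗ₜ[ℂ] l), (prodRep (prodRep ρ σ) τ).hom x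
        (toHilbert (toHilbert (h' ⊗ₜ[ℂ] k') ⊗ₜ[ℂ] l'))⟫_ℂ =
      ⟪toHilbert (h ⊗ₜ[ℂ] toHilbert (k ⊗ₜ[ℂ] l)), (prodRep ρ (prodRep σ τ)).hom y
        (toHilbert (h' ⊗ₜ[ℂ] toHilbert (k' ⊗ₜ[ℂ] l')))⟫_ℂ

section QuantumGroups

variable {A A' C : Type u} [CStarAlgebra A] [CStarAlgebra A'] [CStarAlgebra C]

/-- `(A, Δ)` is a compact quantum group. -/
structure IsCompactQuantumGroup (Δ : A →⋆ₐ[ℂ] SpatialTensor A A) : Prop where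
  coassoc : ∀ a, AssocEq (map Δ (StarAlgHom.id ℂ A) (Δ a)) (map (StarAlgHom.id ℂ A) Δ (Δ a))
  dense_left : Dense
    (Submodule.span ℂ {x : SpatialTensor A A | ∃ b c, x = tmul b 1 * Δ c} :
      Set (SpatialTensor A A))
  dense_right : Dense
    (Submodule.span ℂ {x : SpatialTensor A A | ∃ b c, x = tmul 1 b * Δ c} :
      Set (SpatialTensor A A))

/-- `(A', Δ')` is a compact quantum subgroup of `(A, Δ)` through `π`. -/
structure IsQuantumSubgroup (Δ : A →⋆ₐ[ℂ] SpatialTensor A A) (Δ' : A' →⋆ₐ[ℂ] SpatialTensor A' A')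
    (π : A →⋆ₐ[ℂ] A') : Prop where
  surjective : Function.Surjective π
  map_comul : ∀ a, map π π (Δ a) = Δ' (π a)

/-- `δ` is an action of `(A, Δ)` on `C`. -/
def IsAction (Δ : A →⋆ₐ[ℂ] SpatialTensor A A) (δ : C →⋆ₐ[ℂ] SpatialTensor C A) : Prop :=
  ∀ c, AssocEq (map δ (StarAlgHom.id ℂ A) (δ c)) (map (StarAlgHom.id ℂ C) Δ (δ c))

/-- `e` is an everywhere defined counit of `(A, Δ)`: a character of `A` with `(ι ⊗ e) ∘ Δ = ι`. -/
def IsCounit (Δ : A →⋆ₐ[ℂ] SpatialTensor A A) (e : A →⋆ₐ[ℂ] ℂ) : Prop :=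
  ∀ a, sliceRight e (Δ a) = a

/-- The opposite action `(π ⊗ ι) ∘ Δ` on `A` of the quantum subgroup defined by `π`. -/
noncomputable def oppositeAction (Δ : A →⋆ₐ[ℂ] SpatialTensor A A) (π : A →⋆ₐ[ℂ] A') :
    A →⋆ₐ[ℂ] SpatialTensor A' A :=
  (map π (StarAlgHom.id ℂ A)).comp Δ

/-- The quantum right coset space of the quantum subgroup defined by `π`: the algebra of all `a`
with `(π ⊗ ι) (Δ a) = I ⊗ a`. -/
noncomputable def rightCosetSpace (Δ : A →⋆ₐ[ℂ] SpatialTensor A A) (π : A →⋆ₐ[ℂ] A') :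
    StarSubalgebra ℂ A :=
  StarAlgHom.equalizer (oppositeAction Δ π) inr

instance isClosed_rightCosetSpace (Δ : A →⋆ₐ[ℂ] SpatialTensor A A) (π : A →⋆ₐ[ℂ] A') :
    IsClosed (rightCosetSpace Δ π : Set A) :=
  isClosed_eq
    (AddMonoidHomClass.continuous_of_bound (oppositeAction Δ π) 1 fun a => by
      rw [one_mul]; exact NonUnitalStarAlgHom.norm_apply_le _ a)
    (AddMonoidHomClass.continuous_of_bound (inr (A := A') (B := A)) 1 fun a => by
      rw [one_mul]; exact NonUnitalStarAlgHom.norm_apply_le _ a)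

noncomputable instance (Δ : A →⋆ₐ[ℂ] SpatialTensor A A) (π : A →⋆ₐ[ℂ] A') :
    CStarAlgebra (rightCosetSpace Δ π) :=
  StarSubalgebra.cstarAlgebra (rightCosetSpace Δ π)

/-- A character of a `C*`-algebra, as a unital `*`-homomorphism. -/
noncomputable def charHom (χ : WeakDual.characterSpace ℂ C) : C →⋆ₐ[ℂ] ℂ where
  __ := WeakDual.CharacterSpace.toAlgHom χ
  map_star' := map_star χ

/-- The map `T_χ = (χ ⊗ ι) ∘ δ`. -/
noncomputable def orbitMap (δ : C →⋆ₐ[ℂ] SpatialTensor C A) (χ : WeakDual.characterSpace ℂ C) :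
    C →⋆ₐ[ℂ] A :=
  (sliceLeft (charHom χ)).comp δ

/-- The closed two-sided ideal of `A` generated by the elements `(χ ⊗ ι) (δ c) - χ c • I`. -/
def stabilizerIdeal (δ : C →⋆ₐ[ℂ] SpatialTensor C A) (χ : WeakDual.characterSpace ℂ C) : Set A :=
  closure (TwoSidedIdeal.span (Set.range fun c => orbitMap δ χ c - χ c • (1 : A)) : Set A)

end QuantumGroups

end CQG

/-! Slicing the first leg of the action identity by `χ` gives `Δ ∘ T_χ = (T_χ ⊗ ι) ∘ δ`
(`IsAction.comul_orbitMap`). If `π` kills all `T_χ c - χ c • 1`, then `π ∘ T_χ` is the scalar map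
`χ`, so for every `g` one has `(π ⊗ g) (Δ (T_χ c)) = I ⊗ g (T_χ c)` (`IsAction.map_comul_orbitMap`).
Taking `g = ι` places `T_χ c` in the coset space. Taking `g = π` shows that `(π ⊗ π) ∘ Δ` kills the
generators of the ideal, hence factors through `π` as `Δ'`. Coassociativity and the density
conditions pass along the surjection `π`. For the counit, applying `δ` to `(ι ⊗ e) (δ c)` gives `δ
c`, and injectivity of `δ` yields `(ι ⊗ e) ∘ δ = ι`.

Two supports are needed. The quotient by a closed self-adjoint ideal is a `C*`-algebra, by means of
approximate units. And since `AssocEq` compares only matrix coefficients, a character is treated as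
a one-dimensional representation: slicing by it is then a matrix coefficient, and coefficients
between elementary tensors separate the points of the spatial tensor product. -/

namespace CQG

open scoped TensorProduct InnerProductSpace

/-! ### Quotients of `C*`-algebras by closed self-adjoint ideals. -/

section Quotient

variable {A : Type u} [CStarAlgebra A]

/-- A closed self-adjoint ideal contains, for each of its elements `j`, a self-adjoint `e` with
`‖1 - e‖ ≤ 1` that almost fixes `j`. -/
theorem exists_approximate_unit (I : Ideal A) (hI : IsClosed (I : Set A))
    (hstar : ∀ a ∈ I, star a ∈ I) {j : A} (hj : j ∈ I) {ε : ℝ} (hε : 0 < ε) :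
    ∃ e ∈ I, star e = e ∧ ‖1 - e‖ ≤ 1 ∧ ‖(1 - e) * j‖ < ε := by
  -- The ideal is itself a non-unital `C*`-algebra, so it has an increasing approximate unit.
  let S : NonUnitalStarSubalgebra ℂ A :=
    { carrier := I
      add_mem' := I.add_mem
      zero_mem' := I.zero_mem
      mul_mem' := fun {a b} _ hb => I.mul_mem_left a hb
      smul_mem' := fun r a ha => by
        rw [← smul_one_mul]
        exact I.mul_mem_left _ ha
      star_mem' := fun {a} ha => hstar a ha }
  have : IsClosed (S : Set A) := hI
  let _ : NonUnitalCStarAlgebra S := NonUnitalStarSubalgebra.nonUnitalCStarAlgebra S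
  let _ : PartialOrder S := CStarAlgebra.spectralOrder S
  have _ : StarOrderedRing S := CStarAlgebra.spectralOrderedRing S
  let _ : PartialOrder A := CStarAlgebra.spectralOrder A
  have _ : StarOrderedRing A := CStarAlgebra.spectralOrderedRing A
  have hu := CStarAlgebra.increasingApproximateUnit S
  have ht := (hu.tendsto_mul_right ⟨j, hj⟩).eventually (Metric.ball_mem_nhds _ hε)
  obtain ⟨e, he, he0, he1⟩ := (ht.and (hu.eventually_nonneg.and hu.eventually_norm)).exists
  -- `S` and `A` carry separate spectral orders; positivity is transported by writing `e` as `star b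
  -- * b`.
  have hpos : 0 ≤ (e : A) := by
    obtain ⟨b, hb⟩ := CStarAlgebra.nonneg_iff_eq_star_mul_self.mp he0
    rw [hb]
    exact star_mul_self_nonneg (b : A)
  have hle : (e : A) ≤ 1 := (CStarAlgebra.norm_le_one_iff_of_nonneg _ hpos).mp he1
  refine ⟨e, e.2, (IsSelfAdjoint.of_nonneg hpos).star_eq, ?_, ?_⟩
  · exact (CStarAlgebra.norm_le_one_iff_of_nonneg _ (sub_nonneg.mpr hle)).mpr (sub_le_self _ hpos)
  · rw [dist_eq_norm] at he
    rw [sub_mul, one_mul, norm_sub_rev]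
    exact he

variable (I : Ideal A) [I.IsTwoSided]

/-- Modulo `I` one may replace `x` by `x * (1 - e)` with `e ∈ I`. Its squared norm is that of `(1 -
e) * (star x * x) * (1 - e)`. Splitting `star x * x` into a nearly norm-minimal representative `y`
of its class plus an element of `I`, the factors `1 - e` do not increase the norm of the first part
and make the second small. -/
theorem norm_quotient_mk_sq_le (hI : IsClosed (I : Set A)) (hstar : ∀ a ∈ I, star a ∈ I) (x : A) :
    ‖Ideal.Quotient.mk I x‖ * ‖Ideal.Quotient.mk I x‖ ≤ ‖Ideal.Quotient.mk I (star x * x)‖ := by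
  refine le_of_forall_pos_le_add fun ε hε => ?_
  -- Half of `ε` is spent on the choice of `y`, the other half on the term in `I`.
  obtain ⟨y, hy, hyn⟩ := Submodule.Quotient.norm_mk_lt (Ideal.Quotient.mk I (star x * x))
    (half_pos hε)
  have hj : star x * x - y ∈ I := (Submodule.Quotient.eq I).mp hy.symm
  obtain ⟨e, he, hes, he1, hej⟩ := exists_approximate_unit I hI hstar hj (half_pos hε)
  have hmk : Ideal.Quotient.mk I x = Ideal.Quotient.mk I (x * (1 - e)) := by
    rw [Ideal.Quotient.eq, mul_sub, mul_one, sub_sub_cancel]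
    exact I.mul_mem_left x he
  have hn : ‖Ideal.Quotient.mk I x‖ ≤ ‖x * (1 - e)‖ := by
    rw [hmk]
    exact Submodule.Quotient.norm_mk_le I _
  have hsplit : star (x * (1 - e)) * (x * (1 - e)) =
      (1 - e) * y * (1 - e) + (1 - e) * (star x * x - y) * (1 - e) := by
    rw [star_mul, star_sub, star_one, hes]
    noncomm_ring
  calc ‖Ideal.Quotient.mk I x‖ * ‖Ideal.Quotient.mk I x‖
      ≤ ‖x * (1 - e)‖ * ‖x * (1 - e)‖ := mul_self_le_mul_self (norm_nonneg _) hn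
    _ = ‖(1 - e) * y * (1 - e) + (1 - e) * (star x * x - y) * (1 - e)‖ := by
      rw [← CStarRing.norm_star_mul_self, hsplit]
    _ ≤ ‖(1 - e) * y * (1 - e)‖ + ‖(1 - e) * (star x * x - y) * (1 - e)‖ := norm_add_le _ _
    _ ≤ ‖y‖ + ε / 2 := by
      gcongr
      · calc ‖(1 - e) * y * (1 - e)‖ ≤ ‖1 - e‖ * ‖y‖ * ‖1 - e‖ :=
              (norm_mul_le _ _).trans (by gcongr; exact norm_mul_le _ _)
          _ ≤ 1 * ‖y‖ * 1 := by gcongr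
          _ = ‖y‖ := by ring
      · calc ‖(1 - e) * (star x * x - y) * (1 - e)‖
            ≤ ‖(1 - e) * (star x * x - y)‖ * ‖1 - e‖ := norm_mul_le _ _
          _ ≤ ε / 2 * 1 := by gcongr
          _ = ε / 2 := mul_one _
    _ ≤ ‖Ideal.Quotient.mk I (star x * x)‖ + ε := by linarith

theorem norm_quotient_mul_le (x y : A ⧸ I) : ‖x * y‖ ≤ ‖x‖ * ‖y‖ := by
  have h : ∀ ε > 0, ‖x * y‖ ≤ (‖x‖ + ε) * (‖y‖ + ε) := fun ε hε => by
    obtain ⟨a, rfl, ha⟩ := Submodule.Quotient.norm_mk_lt x hε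
    obtain ⟨b, rfl, hb⟩ := Submodule.Quotient.norm_mk_lt y hε
    calc _ ≤ ‖a * b‖ := Submodule.Quotient.norm_mk_le I (a * b)
      _ ≤ ‖a‖ * ‖b‖ := norm_mul_le a b
      _ ≤ _ := by gcongr
  have hc : Filter.Tendsto (fun ε : ℝ => (‖x‖ + ε) * (‖y‖ + ε)) (nhdsWithin 0 (Set.Ioi 0))
      (nhds ((‖x‖ + 0) * (‖y‖ + 0))) :=
    ((by fun_prop : Continuous fun ε : ℝ => (‖x‖ + ε) * (‖y‖ + ε)).tendsto 0).mono_left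
      nhdsWithin_le_nhds
  simpa using ge_of_tendsto hc (eventually_mem_nhdsWithin.mono h)

/-- The adjoint on the quotient by a self-adjoint two-sided ideal. -/
@[reducible]
def quotientStarRing (hstar : ∀ a ∈ I, star a ∈ I) : StarRing (A ⧸ I) where
  star := Quotient.map' star fun a b h => by
    rw [Submodule.quotientRel_def] at h ⊢
    rw [← star_sub]
    exact hstar _ h
  star_involutive x := by
    obtain ⟨a, rfl⟩ := Ideal.Quotient.mk_surjective x
    exact congrArg (Ideal.Quotient.mk I) (star_star a)
  star_mul x y := by
    obtain ⟨a, rfl⟩ := Ideal.Quotient.mk_surjective x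
    obtain ⟨b, rfl⟩ := Ideal.Quotient.mk_surjective y
    exact congrArg (Ideal.Quotient.mk I) (star_mul a b)
  star_add x y := by
    obtain ⟨a, rfl⟩ := Ideal.Quotient.mk_surjective x
    obtain ⟨b, rfl⟩ := Ideal.Quotient.mk_surjective y
    exact congrArg (Ideal.Quotient.mk I) (star_add a b)

/-- The quotient of a `C*`-algebra by a closed self-adjoint two-sided ideal. -/
@[reducible]
noncomputable def quotientCStarAlgebra (hI : IsClosed (I : Set A))
    (hstar : ∀ a ∈ I, star a ∈ I) : CStarAlgebra (A ⧸ I) :=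
  have : IsClosed (I : Set A) := hI
  { Submodule.Quotient.normedAddCommGroup I, Ideal.Quotient.ring I, quotientStarRing I hstar,
    Submodule.Quotient.normedSpace I ℂ, Ideal.Quotient.algebra ℂ with
    norm_mul_le := norm_quotient_mul_le I
    complete := (Submodule.Quotient.completeSpace I).complete
    norm_mul_self_le := fun x => by
      obtain ⟨a, rfl⟩ := Ideal.Quotient.mk_surjective x
      exact norm_quotient_mk_sq_le I hI hstar a
    star_smul := fun r x => by
      obtain ⟨a, rfl⟩ := Ideal.Quotient.mk_surjective x
      exact congrArg (Ideal.Quotient.mk I) (star_smul r a) }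

theorem exists_quotient_hom (hI : IsClosed (I : Set A)) (hstar : ∀ a ∈ I, star a ∈ I) :
    ∃ (A' : Type u) (_ : CStarAlgebra A') (π : A →⋆ₐ[ℂ] A'),
      Function.Surjective π ∧ ∀ a, π a = 0 ↔ a ∈ I := by
  let _ := quotientCStarAlgebra I hI hstar
  refine ⟨A ⧸ I, inferInstance,
    { toFun := Ideal.Quotient.mk I
      map_one' := rfl
      map_mul' := fun _ _ => rfl
      map_zero' := rfl
      map_add' := fun _ _ => rfl
      commutes' := fun _ => rfl
      map_star' := fun _ => rfl }, Ideal.Quotient.mk_surjective, fun a => ?_⟩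
  exact Ideal.Quotient.eq_zero_iff_mem

end Quotient

/-! ### Factoring homomorphisms through a surjection. -/

section Factor

variable {A A' D : Type u} [CStarAlgebra A] [CStarAlgebra A'] [CStarAlgebra D]

/-- The map is `φ` after a set-theoretic section of `π`. The kernel condition makes `φ` independent
of the chosen lift, and each algebraic law is an instance of this independence. -/
theorem exists_factor {π : A →⋆ₐ[ℂ] A'} (hπ : Function.Surjective π) (φ : A →⋆ₐ[ℂ] D)
    (h : ∀ a, π a = 0 → φ a = 0) : ∃ ψ : A' →⋆ₐ[ℂ] D, ∀ a, ψ (π a) = φ a := by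
  have key : ∀ a b, π a = π b → φ a = φ b := fun a b hab =>
    sub_eq_zero.mp (by rw [← map_sub]; exact h _ (by rw [map_sub, hab, sub_self]))
  let s := Function.surjInv hπ
  have hs : ∀ x, π (s x) = x := Function.surjInv_eq hπ
  refine ⟨{ toFun := fun x => φ (s x), map_one' := ?_, map_mul' := ?_, map_zero' := ?_,
            map_add' := ?_, commutes' := ?_, map_star' := ?_ }, fun a => key _ _ (hs _)⟩
  · rw [← map_one φ]; exact key _ _ (by rw [hs, map_one])
  · intro x y; rw [← map_mul φ]; exact key _ _ (by rw [hs, map_mul, hs, hs])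
  · rw [← map_zero φ]; exact key _ _ (by rw [hs, map_zero])
  · intro x y; rw [← map_add φ]; exact key _ _ (by rw [hs, map_add, hs, hs])
  · intro r; rw [← AlgHomClass.commutes φ r]; exact key _ _ (by rw [hs, AlgHomClass.commutes])
  · intro x; rw [← map_star φ]; exact key _ _ (by rw [hs, map_star, hs])

end Factor

/-! ### Extensionality and matrix coefficients on the spatial tensor product. -/

namespace SpatialTensor

variable {A B : Type u} [CStarAlgebra A] [CStarAlgebra B]

/-- A unital `*`-homomorphism as a continuous linear map. -/
noncomputable def homCLM {D : Type*} [CStarAlgebra D] (f : A →⋆ₐ[ℂ] D) : A →L[ℂ] D :=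
  LinearMap.mkContinuous f.toAlgHom.toLinearMap 1 fun a => by
    rw [one_mul]
    exact NonUnitalStarAlgHom.norm_apply_le f a

theorem homCLM_apply {D : Type*} [CStarAlgebra D] (f : A →⋆ₐ[ℂ] D) (a : A) :
    homCLM f a = f a := rfl

/-- Stated for continuous linear maps rather than homomorphisms because it must also apply to matrix
coefficients, which need not be multiplicative. -/
theorem clm_ext {E : Type*} [NormedAddCommGroup E] [NormedSpace ℂ E]
    {F G : SpatialTensor A B →L[ℂ] E} (h : ∀ a b, F (tmul a b) = G (tmul a b)) : F = G := by
  ext x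
  induction x using SpatialTensor.induction with
  | hp => exact isClosed_eq F.continuous G.continuous
  | ih t =>
    change F (of t) = G (of t)
    induction t using TensorProduct.induction_on with
    | zero => rw [map_zero, map_zero, map_zero]
    | add x y hx hy => rw [map_add, map_add, map_add, hx, hy]
    | tmul a b => exact h a b

theorem hom_ext {D : Type*} [CStarAlgebra D] {f g : SpatialTensor A B →⋆ₐ[ℂ] D}
    (h : ∀ a b, f (tmul a b) = g (tmul a b)) (x : SpatialTensor A B) : f x = g x :=
  congrArg (fun F : SpatialTensor A B →L[ℂ] D => F x) (clm_ext (F := homCLM f) (G := homCLM g) h)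

theorem map_map {A' A'' B' B'' : Type u} [CStarAlgebra A'] [CStarAlgebra A''] [CStarAlgebra B']
    [CStarAlgebra B''] (f : A →⋆ₐ[ℂ] A') (f' : A' →⋆ₐ[ℂ] A'') (g : B →⋆ₐ[ℂ] B')
    (g' : B' →⋆ₐ[ℂ] B'') (x : SpatialTensor A B) :
    map f' g' (map f g x) = map (f'.comp f) (g'.comp g) x :=
  hom_ext (f := (map f' g').comp (map f g)) (fun a b => by
    rw [StarAlgHom.comp_apply, map_tmul, map_tmul, map_tmul]; rfl) x

/-- The norm is a supremum over product representations only on the algebraic tensor product, so an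
element of the completion has to be approximated. If `t` is close to `x - y`, every product
representation sends `t` and `t - (x - y)` to the same operator; hence the spatial norm of `t` is
small, and so is `x - y`. -/
theorem eq_of_prodRep_eq {x y : SpatialTensor A B}
    (h : ∀ (ρ : Rep A) (σ : Rep B), (prodRep ρ σ).hom x = (prodRep ρ σ).hom y) : x = y := by
  rw [← sub_eq_zero, ← norm_le_zero_iff]
  refine le_of_forall_pos_le_add fun ε hε => ?_
  obtain ⟨t, ht⟩ := Metric.denseRange_iff.mp denseRange_coe (x - y) (ε / 2) (half_pos hε)
  rw [dist_eq_norm] at ht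
  have hrep : ‖coe t‖ ≤ ε / 2 := by
    rw [norm_coe]
    refine spatialNorm_le _ fun ρ σ => ?_
    have h0 : (prodRep ρ σ).hom (x - y) = 0 := by rw [map_sub, h, sub_self]
    have h1 : (prodRep ρ σ).hom (coe t) = (prodRep ρ σ).hom (coe t - (x - y)) := by
      rw [map_sub, h0, sub_zero]
    calc ‖algProdRep ρ.hom σ.hom t‖ = ‖(prodRep ρ σ).hom (coe t)‖ :=
          congrArg norm (prodRep_of ρ σ t).symm
      _ = ‖(prodRep ρ σ).hom (coe t - (x - y))‖ := congrArg norm h1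
      _ ≤ ‖coe t - (x - y)‖ := NonUnitalStarAlgHom.norm_apply_le _ _
      _ ≤ ε / 2 := by rw [norm_sub_rev]; exact ht.le
  calc ‖x - y‖ = ‖(x - y - coe t) + coe t‖ := by rw [sub_add_cancel]
    _ ≤ ‖x - y - coe t‖ + ‖coe t‖ := norm_add_le _ _
    _ ≤ 0 + ε := by linarith

/-- The matrix coefficient `a ↦ ⟪ξ, ρ a η⟫` of a representation. -/
noncomputable def coeff (ρ : Rep A) (ξ η : ρ.H) : A →L[ℂ] ℂ :=
  (innerSL ℂ ξ) ∘L (ContinuousLinearMap.apply ℂ ρ.H η) ∘L homCLM ρ.hom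

theorem coeff_apply (ρ : Rep A) (ξ η : ρ.H) (a : A) : coeff ρ ξ η a = ⟪ξ, ρ.hom a η⟫_ℂ := rfl

/-- The elementary tensor of two vectors, in the space of the product representation. -/
noncomputable def vecTensor {ρ : Rep A} {σ : Rep B} (h : ρ.H) (k : σ.H) : (prodRep ρ σ).H :=
  (toHilbert (h ⊗ₜ[ℂ] k) : HilbertTensor ρ.H σ.H)

theorem coeff_tmul (ρ : Rep A) (σ : Rep B) (h h' : ρ.H) (k k' : σ.H) (a : A) (b : B) :
    coeff (prodRep ρ σ) (vecTensor h k) (vecTensor h' k') (tmul a b) =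
      coeff ρ h h' a * coeff σ k k' b := by
  have hop : (prodRep ρ σ).hom (tmul a b) (vecTensor h' k') =
      vecTensor (ρ.hom a h') (σ.hom b k') := by
    refine (congrArg (fun S : HilbertTensor ρ.H σ.H →L[ℂ] HilbertTensor ρ.H σ.H =>
      S (toHilbert (h' ⊗ₜ[ℂ] k'))) (prodRep_of ρ σ (a ⊗ₜ[ℂ] b))).trans ?_
    exact opTensor_coe (ρ.hom a) (σ.hom b) (h' ⊗ₜ[ℂ] k')
  rw [coeff_apply, hop, coeff_apply, coeff_apply]
  refine (LinearIsometry.inner_map_map (toHilbert (H := ρ.H) (K := σ.H)) _ _).trans ?_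
  exact TensorProduct.inner_tmul (𝕜 := ℂ) h (ρ.hom a h') k (σ.hom b k')

theorem operator_ext_of_inner {H K : Type u} [NormedAddCommGroup H] [InnerProductSpace ℂ H]
    [NormedAddCommGroup K] [InnerProductSpace ℂ K]
    {S T : HilbertTensor H K →L[ℂ] HilbertTensor H K}
    (h : ∀ (h h' : H) (k k' : K),
      ⟪toHilbert (h ⊗ₜ[ℂ] k), S (toHilbert (h' ⊗ₜ[ℂ] k'))⟫_ℂ =
        ⟪toHilbert (h ⊗ₜ[ℂ] k), T (toHilbert (h' ⊗ₜ[ℂ] k'))⟫_ℂ) : S = T := by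
  refine hilbertTensor_ext fun x => ?_
  induction x using TensorProduct.induction_on with
  | zero => simp
  | add x y hx hy => simp only [map_add, hx, hy]
  | tmul h' k' =>
    refine ext_inner_left ℂ fun v => ?_
    induction v using HilbertTensor.induction with
    | hp => apply isClosed_eq <;> fun_prop
    | ih v =>
      induction v using TensorProduct.induction_on with
      | zero => simp
      | add x y hx hy => simp only [map_add, inner_add_left, hx, hy]
      | tmul h₀ k₀ => exact h h₀ h' k₀ k'

/-- This turns information of the kind contained in `AssocEq` into genuine equality of tensors. -/
theorem eq_of_coeff_eq {x y : SpatialTensor A B}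
    (h : ∀ (ρ : Rep A) (σ : Rep B) (h h' : ρ.H) (k k' : σ.H),
      coeff (prodRep ρ σ) (vecTensor h k) (vecTensor h' k') x =
        coeff (prodRep ρ σ) (vecTensor h k) (vecTensor h' k') y) : x = y :=
  eq_of_prodRep_eq fun ρ σ => operator_ext_of_inner (h ρ σ)

/-- A character, as a one-dimensional representation. -/
noncomputable def charRep (χ : A →⋆ₐ[ℂ] ℂ) : Rep A :=
  ⟨EuclideanSpace ℂ PUnit.{u + 1}, scalarHom χ _⟩

/-- The unit vector of the one-dimensional representation given by a character. -/
noncomputable def charVec (χ : A →⋆ₐ[ℂ] ℂ) : (charRep χ).H :=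
  (EuclideanSpace.single PUnit.unit (1 : ℂ) : EuclideanSpace ℂ PUnit.{u + 1})

theorem coeff_charRep (χ : A →⋆ₐ[ℂ] ℂ) (a : A) :
    coeff (charRep χ) (charVec χ) (charVec χ) a = χ a := by
  have h : (charRep χ).hom a (charVec χ) = χ a • charVec χ := by
    exact congrArg (fun S : (charRep χ).H →L[ℂ] (charRep χ).H => S (charVec χ))
      (scalarHom_apply χ ((charRep χ).H →L[ℂ] (charRep χ).H) a)
  have h1 : ⟪charVec χ, charVec χ⟫_ℂ = 1 := by
    change ⟪EuclideanSpace.single PUnit.unit (1 : ℂ), EuclideanSpace.single PUnit.unit (1 : ℂ)⟫_ℂ = 1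
    simp
  rw [coeff_apply, h, inner_smul_right, h1, mul_one]

/-- By `coeff_charRep` the first leg contributes the factor `χ a`, so slicing amounts to fixing the
one-dimensional representation and its unit vector in that leg. -/
theorem coeff_sliceLeft (χ : A →⋆ₐ[ℂ] ℂ) (σ : Rep B) (k k' : σ.H) (x : SpatialTensor A B) :
    coeff (prodRep (charRep χ) σ) (vecTensor (charVec χ) k) (vecTensor (charVec χ) k')
      x = coeff σ k k' (sliceLeft χ x) := by
  refine congrArg (fun F : SpatialTensor A B →L[ℂ] ℂ => F x)
    (clm_ext (G := coeff σ k k' ∘L homCLM (sliceLeft χ)) fun a b => ?_)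
  rw [coeff_tmul, coeff_charRep, ContinuousLinearMap.comp_apply, homCLM_apply, sliceLeft_tmul,
    map_smul, smul_eq_mul]

theorem coeff_sliceRight (χ : B →⋆ₐ[ℂ] ℂ) (ρ : Rep A) (h h' : ρ.H) (x : SpatialTensor A B) :
    coeff (prodRep ρ (charRep χ)) (vecTensor h (charVec χ)) (vecTensor h' (charVec χ))
      x = coeff ρ h h' (sliceRight χ x) := by
  refine congrArg (fun F : SpatialTensor A B →L[ℂ] ℂ => F x)
    (clm_ext (G := coeff ρ h h' ∘L homCLM (sliceRight χ)) fun a b => ?_)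
  rw [coeff_tmul, coeff_charRep, ContinuousLinearMap.comp_apply, homCLM_apply, sliceRight_tmul,
    map_smul, smul_eq_mul, mul_comm]

/-! ### Consequences of the associativity relation. -/

section Assoc

variable {C : Type u} [CStarAlgebra C]

theorem AssocEq.coeff_eq {x : SpatialTensor (SpatialTensor A B) C}
    {y : SpatialTensor A (SpatialTensor B C)} (hxy : AssocEq x y) {ρ : Rep A} {σ : Rep B}
    {τ : Rep C} (h h' : ρ.H) (k k' : σ.H) (l l' : τ.H) :
    coeff (prodRep (prodRep ρ σ) τ) (vecTensor (vecTensor h k) l)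
        (vecTensor (vecTensor h' k') l') x =
      coeff (prodRep ρ (prodRep σ τ)) (vecTensor h (vecTensor k l))
        (vecTensor h' (vecTensor k' l')) y :=
  hxy ρ σ τ h h' k k' l l'

/-- Specialise the first representation in `AssocEq` to the one-dimensional one given by `χ`; both
sides become coefficients of slices. -/
theorem AssocEq.sliceLeft_eq {x : SpatialTensor (SpatialTensor A B) C}
    {y : SpatialTensor A (SpatialTensor B C)} (h : AssocEq x y) (χ : A →⋆ₐ[ℂ] ℂ) :
    map (sliceLeft χ) (StarAlgHom.id ℂ C) x = sliceLeft χ y := by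
  refine eq_of_coeff_eq fun σ τ k k' l l' => ?_
  rw [← coeff_sliceLeft]
  refine Eq.trans ?_ (h.coeff_eq (charVec χ) (charVec χ) k k' l l')
  refine (congrArg (fun F : SpatialTensor (SpatialTensor A B) C →L[ℂ] ℂ => F x)
    (clm_ext (F := coeff (prodRep (prodRep (charRep χ) σ) τ) _ _)
      (G := coeff (prodRep σ τ) _ _ ∘L homCLM (map (sliceLeft χ) (StarAlgHom.id ℂ C)))
      fun a b => ?_)).symm
  rw [coeff_tmul, ContinuousLinearMap.comp_apply, homCLM_apply, map_tmul, coeff_tmul]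
  exact congrArg (· * _) (coeff_sliceLeft χ σ _ _ a)

theorem AssocEq.sliceRight_eq {x : SpatialTensor (SpatialTensor A B) C}
    {y : SpatialTensor A (SpatialTensor B C)} (h : AssocEq x y) (χ : C →⋆ₐ[ℂ] ℂ) :
    sliceRight χ x = map (StarAlgHom.id ℂ A) (sliceRight χ) y := by
  refine eq_of_coeff_eq fun ρ σ k k' l l' => ?_
  rw [← coeff_sliceRight]
  refine Eq.trans (h.coeff_eq k k' l l' (charVec χ) (charVec χ)) ?_
  refine congrArg (fun F : SpatialTensor A (SpatialTensor B C) →L[ℂ] ℂ => F y)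
    (clm_ext (F := coeff (prodRep ρ (prodRep σ (charRep χ))) _ _)
      (G := coeff (prodRep ρ σ) _ _ ∘L homCLM (map (StarAlgHom.id ℂ A) (sliceRight χ)))
      fun a b => ?_)
  rw [coeff_tmul, ContinuousLinearMap.comp_apply, homCLM_apply, map_tmul, coeff_tmul]
  exact congrArg (_ * ·) (coeff_sliceRight χ σ _ _ b)

/-- A vector, in the space of the pull-back of a representation. -/
def compVec {A' : Type u} [CStarAlgebra A'] {ρ : Rep A'} (f : A →⋆ₐ[ℂ] A') (h : ρ.H) :
    (ρ.comp f).H := h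

theorem coeff_compVec {A' : Type u} [CStarAlgebra A'] (ρ : Rep A') (f : A →⋆ₐ[ℂ] A')
    (h h' : ρ.H) (a : A) :
    coeff (ρ.comp f) (compVec f h) (compVec f h') a = coeff ρ h h' (f a) := rfl

/-- If matrix coefficients of two pairs of representations correspond to each other under `f` and
`g`, then so do those of the product representations under `f ⊗ g`. -/
theorem coeff_map {A' B' : Type u} [CStarAlgebra A'] [CStarAlgebra B'] (f : A →⋆ₐ[ℂ] A')
    (g : B →⋆ₐ[ℂ] B') {ρ : Rep A} {ρ' : Rep A'} {σ : Rep B} {σ' : Rep B'} {h₁ h₂ : ρ.H}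
    {h₁' h₂' : ρ'.H} {k₁ k₂ : σ.H} {k₁' k₂' : σ'.H}
    (hf : ∀ a, coeff ρ' h₁' h₂' (f a) = coeff ρ h₁ h₂ a)
    (hg : ∀ b, coeff σ' k₁' k₂' (g b) = coeff σ k₁ k₂ b) (x : SpatialTensor A B) :
    coeff (prodRep ρ' σ') (vecTensor h₁' k₁') (vecTensor h₂' k₂') (map f g x) =
      coeff (prodRep ρ σ) (vecTensor h₁ k₁) (vecTensor h₂ k₂) x := by
  refine congrArg (fun F : SpatialTensor A B →L[ℂ] ℂ => F x)
    (clm_ext (F := coeff (prodRep ρ' σ') _ _ ∘L homCLM (map f g)) fun a b => ?_)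
  rw [coeff_tmul, ContinuousLinearMap.comp_apply, homCLM_apply, map_tmul, coeff_tmul, hf, hg]

/-- Coefficients of the images are coefficients of `x` and `y` in the representations pulled back
along `f`, `g`, `q`, over which `AssocEq` already quantifies. -/
theorem AssocEq.map {A' B' C' : Type u} [CStarAlgebra A'] [CStarAlgebra B'] [CStarAlgebra C']
    {x : SpatialTensor (SpatialTensor A B) C} {y : SpatialTensor A (SpatialTensor B C)}
    (hxy : AssocEq x y) (f : A →⋆ₐ[ℂ] A') (g : B →⋆ₐ[ℂ] B') (q : C →⋆ₐ[ℂ] C') :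
    AssocEq (SpatialTensor.map (SpatialTensor.map f g) q x)
      (SpatialTensor.map f (SpatialTensor.map g q) y) := by
  intro ρ σ τ h h' k k' l l'
  have hf := fun a => (coeff_compVec ρ f h h' a).symm
  have hg := fun b => (coeff_compVec σ g k k' b).symm
  have hq := fun c => (coeff_compVec τ q l l' c).symm
  exact (coeff_map _ q (coeff_map f g hf hg) hq x).trans
    ((hxy.coeff_eq _ _ _ _ _ _).trans (coeff_map f _ hf (coeff_map g q hg hq) y).symm)

end Assoc

end SpatialTensor

open SpatialTensor

/-! ### The orbit map, the stabilizer ideal and its quotient. -/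

section QuantumGroups

variable {A A' C : Type u} [CStarAlgebra A] [CStarAlgebra A'] [CStarAlgebra C]

theorem sliceLeft_map {B D : Type u} [CStarAlgebra B] [CStarAlgebra D] (χ : C →⋆ₐ[ℂ] ℂ)
    (g : B →⋆ₐ[ℂ] D) (x : SpatialTensor C B) :
    sliceLeft χ (map (StarAlgHom.id ℂ C) g x) = g (sliceLeft χ x) :=
  hom_ext (f := (sliceLeft χ).comp (map (StarAlgHom.id ℂ C) g)) (g := g.comp (sliceLeft χ))
    (fun a b => by
      rw [StarAlgHom.comp_apply, StarAlgHom.comp_apply, map_tmul, sliceLeft_tmul, sliceLeft_tmul,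
        map_smul]
      rfl) x

theorem sliceRight_map {B D : Type u} [CStarAlgebra B] [CStarAlgebra D] (e : B →⋆ₐ[ℂ] ℂ)
    (f : C →⋆ₐ[ℂ] D) (x : SpatialTensor C B) :
    sliceRight e (map f (StarAlgHom.id ℂ B) x) = f (sliceRight e x) :=
  hom_ext (f := (sliceRight e).comp (map f (StarAlgHom.id ℂ B))) (g := f.comp (sliceRight e))
    (fun a b => by
      rw [StarAlgHom.comp_apply, StarAlgHom.comp_apply, map_tmul, sliceRight_tmul,
        sliceRight_tmul, map_smul]
      rfl) x

/-- Both sides are `χ ⊗ e`, evaluated one leg at a time in either order. -/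
theorem apply_sliceLeft (χ : C →⋆ₐ[ℂ] ℂ) (e : A →⋆ₐ[ℂ] ℂ) (x : SpatialTensor C A) :
    e (sliceLeft χ x) = χ (sliceRight e x) :=
  hom_ext (f := e.comp (sliceLeft χ)) (g := χ.comp (sliceRight e)) (fun a b => by
    rw [StarAlgHom.comp_apply, StarAlgHom.comp_apply, sliceLeft_tmul, sliceRight_tmul, map_smul,
      map_smul, smul_eq_mul, smul_eq_mul, mul_comm]) x

/-- Scalars move across the tensor sign: `χ a • 1 ⊗ g b = 1 ⊗ g (χ a • b)`. -/
theorem map_scalarHom {B D : Type u} [CStarAlgebra B] [CStarAlgebra D] (χ : C →⋆ₐ[ℂ] ℂ)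
    (g : B →⋆ₐ[ℂ] D) (x : SpatialTensor C B) :
    map (scalarHom χ A') g x = inr (g (sliceLeft χ x)) :=
  hom_ext (f := map (scalarHom χ A') g) (g := inr.comp (g.comp (sliceLeft χ))) (fun a b => by
    rw [StarAlgHom.comp_apply, StarAlgHom.comp_apply, map_tmul, sliceLeft_tmul, map_smul, map_smul,
      scalarHom_apply, inr_apply, tmul, tmul, ← TensorProduct.smul_tmul', map_smul]) x

variable {Δ : A →⋆ₐ[ℂ] SpatialTensor A A} {δ : C →⋆ₐ[ℂ] SpatialTensor C A}

theorem IsAction.comul_orbitMap (hδ : IsAction Δ δ) (χ : WeakDual.characterSpace ℂ C) (c : C) :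
    Δ (orbitMap δ χ c) = map (orbitMap δ χ) (StarAlgHom.id ℂ A) (δ c) := by
  have h := (hδ c).sliceLeft_eq (charHom χ)
  rw [sliceLeft_map, map_map] at h
  exact h.symm

theorem IsAction.counit_orbitMap (hδ : IsAction Δ δ) (hinj : Function.Injective δ)
    (χ : WeakDual.characterSpace ℂ C) {e : A →⋆ₐ[ℂ] ℂ} (he : IsCounit Δ e) (c : C) :
    e (orbitMap δ χ c) = χ c := by
  have hid : sliceRight e (δ c) = c := by
    apply hinj
    -- Slicing the last leg by `e` turns one side of the action identity into `δ ((ι ⊗ e) (δ c))`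
    -- and, by the counit law, the other into `δ c`.
    have h := (hδ c).sliceRight_eq e
    have hcomp : (sliceRight e).comp Δ = StarAlgHom.id ℂ A := StarAlgHom.ext he
    rw [sliceRight_map, map_map, hcomp] at h
    rw [h]
    exact hom_ext (f := map _ _) (g := StarAlgHom.id ℂ _) (fun a b => map_tmul _ _ a b) (δ c)
  calc e (orbitMap δ χ c) = charHom χ (sliceRight e (δ c)) := apply_sliceLeft (charHom χ) e (δ c)
    _ = χ c := by rw [hid]; rfl

/-- The set of generators is self-adjoint: the adjoint of the generator for `c` is the generator for
`star c`. -/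
theorem star_mem_span_generators (δ : C →⋆ₐ[ℂ] SpatialTensor C A)
    (χ : WeakDual.characterSpace ℂ C) {a : A}
    (ha : a ∈ TwoSidedIdeal.span (Set.range fun c => orbitMap δ χ c - χ c • (1 : A))) :
    star a ∈ TwoSidedIdeal.span (Set.range fun c => orbitMap δ χ c - χ c • (1 : A)) := by
  induction ha using TwoSidedIdeal.span_induction with
  | mem x hx =>
    obtain ⟨c, rfl⟩ := hx
    refine TwoSidedIdeal.subset_span ⟨star c, ?_⟩
    simp only [star_sub, star_smul, star_one, map_star]
  | zero => rw [star_zero]; exact zero_mem _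
  | add x y _ _ hx hy => rw [star_add]; exact add_mem hx hy
  | neg x _ hx => rw [star_neg]; exact neg_mem hx
  | left_absorb a x _ hx => rw [star_mul]; exact TwoSidedIdeal.mul_mem_right _ _ _ hx
  | right_absorb b x _ hx => rw [star_mul]; exact TwoSidedIdeal.mul_mem_left _ _ _ hx

theorem exists_stabilizer_quotient (δ : C →⋆ₐ[ℂ] SpatialTensor C A)
    (χ : WeakDual.characterSpace ℂ C) :
    ∃ (A' : Type u) (_ : CStarAlgebra A') (π : A →⋆ₐ[ℂ] A'),
      Function.Surjective π ∧ {a | π a = 0} = stabilizerIdeal δ χ := by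
  let J := TwoSidedIdeal.span (Set.range fun c => orbitMap δ χ c - χ c • (1 : A))
  let I : Ideal A := (TwoSidedIdeal.asIdeal J).closure
  -- `Ideal` means left ideal, so absorption on the right must be carried to the closure by
  -- continuity.
  have : I.IsTwoSided := ⟨fun {a} b ha => by
    change a * b ∈ closure (J : Set A)
    exact map_mem_closure (f := (· * b)) (by fun_prop) ha fun x hx => J.mul_mem_right x b hx⟩
  obtain ⟨A', hA', π, hπ, hker⟩ := exists_quotient_hom I isClosed_closure fun a ha =>
    map_mem_closure (f := star) continuous_star ha fun x hx => star_mem_span_generators δ χ hx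
  exact ⟨A', hA', π, hπ, Set.ext hker⟩

/-- The universal property of the quotient, to be applied with `φ = (π ⊗ π) ∘ Δ` in order to obtain
`Δ'`. -/
theorem apply_eq_zero_of_mem_stabilizerIdeal {D : Type u} [CStarAlgebra D] {φ : A →⋆ₐ[ℂ] D}
    {χ : WeakDual.characterSpace ℂ C} (h : ∀ c, φ (orbitMap δ χ c) = χ c • (1 : D)) {a : A}
    (ha : a ∈ stabilizerIdeal δ χ) : φ a = 0 := by
  have hcl : IsClosed {a | φ a = 0} := isClosed_eq (homCLM φ).continuous continuous_const
  refine closure_minimal (fun x hx => ?_) hcl ha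
  have hx' : x ∈ TwoSidedIdeal.span (Set.range fun c => orbitMap δ χ c - χ c • (1 : A)) := hx
  change φ x = 0
  clear hx
  induction hx' using TwoSidedIdeal.span_induction with
  | mem x hx =>
    obtain ⟨c, rfl⟩ := hx
    simp only [map_sub, map_smul, map_one, h, sub_self]
  | zero => exact map_zero φ
  | add x y _ _ hx hy => rw [map_add, hx, hy, add_zero]
  | neg x _ hx => rw [map_neg, hx, neg_zero]
  | left_absorb a x _ hx => rw [map_mul, hx, mul_zero]
  | right_absorb b x _ hx => rw [map_mul, hx, zero_mul]

theorem apply_orbitMap_eq {π : A →⋆ₐ[ℂ] A'} {χ : WeakDual.characterSpace ℂ C}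
    (hker : {a | π a = 0} = stabilizerIdeal δ χ) (c : C) :
    π (orbitMap δ χ c) = χ c • (1 : A') := by
  have h : orbitMap δ χ c - χ c • (1 : A) ∈ {a | π a = 0} := by
    rw [hker]
    exact subset_closure (TwoSidedIdeal.subset_span ⟨c, rfl⟩)
  rw [Set.mem_ofPred_eq, map_sub, map_smul, map_one] at h
  exact sub_eq_zero.mp h

theorem denseRange_map {π : A →⋆ₐ[ℂ] A'} (hπ : Function.Surjective π) :
    DenseRange (map π π : SpatialTensor A A → SpatialTensor A' A') := by
  refine denseRange_coe.mono ?_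
  rintro _ ⟨t, rfl⟩
  change of t ∈ _
  induction t using TensorProduct.induction_on with
  | zero => exact ⟨0, by rw [map_zero, map_zero]⟩
  | add x y hx hy =>
    obtain ⟨s, hs⟩ := hx
    obtain ⟨t, ht⟩ := hy
    exact ⟨s + t, by rw [map_add, map_add, hs, ht]⟩
  | tmul a b =>
    obtain ⟨a, rfl⟩ := hπ a
    obtain ⟨b, rfl⟩ := hπ b
    exact ⟨tmul a b, map_tmul π π a b⟩

/-- Applied to `π ⊗ π`, it transfers the two density conditions of a compact quantum group to the
quotient. -/
theorem dense_span_of_denseRange {E F : Type*} [NormedAddCommGroup E] [NormedSpace ℂ E]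
    [NormedAddCommGroup F] [NormedSpace ℂ F] (f : E →L[ℂ] F) (hf : DenseRange f) {s : Set E}
    {t : Set F} (hs : Dense (Submodule.span ℂ s : Set E)) (hst : ∀ x ∈ s, f x ∈ t) :
    Dense (Submodule.span ℂ t : Set F) := by
  refine (hf.dense_image f.continuous hs).mono ?_
  rintro _ ⟨x, hx, rfl⟩
  have hle : Submodule.span ℂ s ≤ (Submodule.span ℂ t).comap f.toLinearMap :=
    Submodule.span_le.mpr fun y hy => Submodule.subset_span (hst y hy)
  exact hle hx

/-- A quantum subgroup of a compact quantum group is a compact quantum group. -/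
theorem IsQuantumSubgroup.isCompactQuantumGroup (hΔ : IsCompactQuantumGroup Δ)
    {Δ' : A' →⋆ₐ[ℂ] SpatialTensor A' A'} {π : A →⋆ₐ[ℂ] A'} (h : IsQuantumSubgroup Δ Δ' π) :
    IsCompactQuantumGroup Δ' where
  coassoc x := by
    obtain ⟨a, rfl⟩ := h.surjective x
    have hc : (map π π).comp Δ = Δ'.comp π := StarAlgHom.ext h.map_comul
    -- Coassociativity of `Δ'` at `π a` is the image under `π ⊗ π ⊗ π` of that of `Δ` at `a`.
    have key := (hΔ.coassoc a).map π π π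
    rw [map_map, map_map, hc] at key
    rw [← h.map_comul, map_map, map_map]
    exact key
  dense_left := dense_span_of_denseRange (homCLM (map π π)) (denseRange_map h.surjective)
    hΔ.dense_left (by
      rintro _ ⟨b, c, rfl⟩
      exact ⟨π b, π c, by rw [homCLM_apply, map_mul, map_tmul, map_one, h.map_comul]⟩)
  dense_right := dense_span_of_denseRange (homCLM (map π π)) (denseRange_map h.surjective)
    hΔ.dense_right (by
      rintro _ ⟨b, c, rfl⟩
      exact ⟨π b, π c, by rw [homCLM_apply, map_mul, map_tmul, map_one, h.map_comul]⟩)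

/-- By equivariance the left side is `((π ∘ T_χ) ⊗ g) (δ c)`, whose first leg is scalar. The
homomorphism `g` is kept general to serve both uses: the identity for the coset space, `π` for the
existence of `Δ'`. -/
theorem IsAction.map_comul_orbitMap (hδ : IsAction Δ δ) {π : A →⋆ₐ[ℂ] A'}
    {χ : WeakDual.characterSpace ℂ C} (h : ∀ c, π (orbitMap δ χ c) = χ c • (1 : A'))
    {D : Type u} [CStarAlgebra D] (g : A →⋆ₐ[ℂ] D) (c : C) :
    map π g (Δ (orbitMap δ χ c)) = inr (g (orbitMap δ χ c)) := by
  have hcomp : π.comp (orbitMap δ χ) = scalarHom (charHom χ) A' :=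
    StarAlgHom.ext fun c => (h c).trans (scalarHom_apply (charHom χ) A' c).symm
  rw [hδ.comul_orbitMap, map_map, hcomp]
  exact map_scalarHom (charHom χ) g (δ c)

end QuantumGroups

end CQG

/-- `(A, Δ)` is a compact quantum group, `δ` an action of it on `C`, `χ` a character of `C`, and
`CQG.orbitMap δ χ` is `T_χ = (χ ⊗ ι) ∘ δ`. The action of `(A, Δ)` on the right coset space is the
restriction of `Δ`, with values in the tensor product of the coset space with `A`, which sits in
`A ⊗ A` through the inclusion of the coset space in `A`. -/
theorem mainTheorem2 {A C : Type u} [CStarAlgebra A] [CStarAlgebra C]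
    (Δ : A →⋆ₐ[ℂ] CQG.SpatialTensor A A) (hΔ : CQG.IsCompactQuantumGroup Δ)
    (δ : C →⋆ₐ[ℂ] CQG.SpatialTensor C A) (hδ : CQG.IsAction Δ δ)
    (χ : WeakDual.characterSpace ℂ C) :
    (∃ (A' : Type u) (_ : CStarAlgebra A') (Δ' : A' →⋆ₐ[ℂ] CQG.SpatialTensor A' A')
      (π : A →⋆ₐ[ℂ] A'),
      CQG.IsCompactQuantumGroup Δ' ∧ CQG.IsQuantumSubgroup Δ Δ' π ∧
      {a | π a = 0} = CQG.stabilizerIdeal δ χ ∧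
      (∃ T : C →⋆ₐ[ℂ] CQG.rightCosetSpace Δ π,
        (∀ c, (T c : A) = CQG.orbitMap δ χ c) ∧
        ∀ c, CQG.SpatialTensor.map (CQG.rightCosetSpace Δ π).subtype (StarAlgHom.id ℂ A)
            (CQG.SpatialTensor.map T (StarAlgHom.id ℂ A) (δ c)) = Δ (T c)) ∧
      ∀ c, π (CQG.orbitMap δ χ c) = χ c • (1 : A')) ∧
    (Function.Injective δ → ∀ e : A →⋆ₐ[ℂ] ℂ, CQG.IsCounit Δ e →
      ∀ c, e (CQG.orbitMap δ χ c) = χ c) := by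
  refine ⟨?_, fun hinj e he c => hδ.counit_orbitMap hinj χ he c⟩
  obtain ⟨A', _, π, hπ, hker⟩ := CQG.exists_stabilizer_quotient δ χ
  have hχ := CQG.apply_orbitMap_eq hker
  -- On `T_χ c` the map `(π ⊗ π) ∘ Δ` takes the value `I ⊗ π (T_χ c) = χ c • 1`, so it vanishes on
  -- the kernel of `π`.
  obtain ⟨Δ', hΔ'⟩ := CQG.exists_factor hπ ((CQG.SpatialTensor.map π π).comp Δ) fun a ha =>
    CQG.apply_eq_zero_of_mem_stabilizerIdeal (δ := δ) (χ := χ)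
      (fun c => by
        rw [StarAlgHom.comp_apply, hδ.map_comul_orbitMap hχ, hχ, map_smul, map_one])
      (hker ▸ ha)
  have hsub : CQG.IsQuantumSubgroup Δ Δ' π := ⟨hπ, fun a => (hΔ' a).symm⟩
  let T : C →⋆ₐ[ℂ] CQG.rightCosetSpace Δ π :=
    StarAlgHom.codRestrict (CQG.orbitMap δ χ) (CQG.rightCosetSpace Δ π) fun c =>
      hδ.map_comul_orbitMap hχ (StarAlgHom.id ℂ A) c
  refine ⟨A', _, Δ', π, hsub.isCompactQuantumGroup hΔ, hsub, hker, ⟨T, fun _ => rfl, fun c => ?_⟩,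
    hχ⟩
  -- The inclusion of the coset space composed with `T` is `orbitMap δ χ` by definition, so only
  -- equivariance remains.
  rw [CQG.SpatialTensor.map_map]
  exact (hδ.comul_orbitMap χ c).symm
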